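/- Let $q\in\mathbb{C}^\times$ not be a root of unity and put $\theta=q-q^{-1}$. Let $\mathbb{V}$ be the braided vector space of diagonal type with basis $x_1,x_2$ and braiding $c(x_i\otimes x_j)=q_{ij}\,x_j\otimes x_i$, where $$(q_{ij})=\begin{pmatrix} q & q^{-1}\\ q^{-1} & -q\end{pmatrix}.$$ Let $\chi:\mathbb{Z}^2\times\mathbb{Z}^2\to\mathbb{C}^\times$ be the bicharacter with $\chi(\alpha_i,\alpha_j)=q_{ij}$, where $\alpha_1,\alpha_2$ is the standard basis of $\mathbb{Z}^2$ and $\deg x_i=\alpha_i$. On the tensor algebra $T(\mathbb{V})$ let $[\cdot,\cdot]$ be the braided bracket, i.e. the bilinear map with $[u,v]=uv-\chi(\deg u,\deg v)\,vu$ for homogeneous $u,v$. Let $B(\mathbb{V})=T(\mathbb{V})/\bigoplus_n\ker\mathfrak{S}_n$ be the Nichols algebra of $\mathbb{V}$, where $\mathfrak{S}_n$ is the quantum symmetrizer on $\mathbb{V}^{\otimes n}$. For a Lyndon word $u$ in the letters $x_1<x_2$ define the super-letter $[u]\in T(\mathbb{V})$ by $[u]=u$ if $u$ is a letter, and $[u]=[[v],[w]]$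 otherwise, where $u=vw$ is the decomposition into two Lyndon words with $v$ as short as possible. For $n\ge1$ let $X_n$ and $Y_n$ be the super-letters of $x_1(x_1x_2)^{n-1}$ and $(x_1x_2)^{n-1}x_2$. Put $L_0=L_0'=\frac1\theta$, $L_n=[X_1,Y_n]$ for $n\ge1$, $L_1'=L_1$, and $L_n'=[X_2,Y_{n-1}]$ for $n\ge2$. Define $P_n$, $Q_n$ by $P_0=Q_0=1$ and, for $n\ge1$, $$P_n=q^n+q^{n-1}+(-1)^{n-1}P_{n-1},\qquad Q_n=q^n-q^{n-1}+(-1)^nQ_{n-1}.$$ Then for every $n\ge0$ the following relations hold in $B(\mathbb{V})$ (empty sums are $0$): $$[X_1,L_{2n}]=\sum_{i=0}^{n-1}P_{2n-1-2i}\,\theta L_{2i}X_{2n+1-2i}-\sum_{i=0}^{n-1}P_{2n-2-2i}\,\theta L_{2i+1}'X_{2n-2i},$$ $$[X_1,L_{2n}']=\sum_{i=0}^{n-1}q^{2n-1-2i}\theta L_{2i}'X_{2n+1-2i}-\sum_{i=0}^{n-1}q^{2n-2-2i}\theta L_{2i+1}X_{2n-2i},$$ $$[X_2,L_{2n}]=\sum_{i=0}^{n-1}q^{2n-1-2i}\theta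 L_{2i}X_{2n+2-2i}+\sum_{i=0}^{n-1}q^{2n-2-2i}\theta L_{2i+1}'X_{2n+1-2i},$$ $$[X_2,L_{2n}']=\sum_{i=0}^{n-1}Q_{2n-1-2i}\,\theta L_{2i}'X_{2n+2-2i}+\sum_{i=0}^{n-1}Q_{2n-2-2i}\,\theta L_{2i+1}X_{2n+1-2i},$$ $$[L_{2n},Y_1]=\sum_{i=0}^{n-1}q^{2n-1-2i}\theta Y_{2n+1-2i}L_{2i}+\sum_{i=0}^{n-1}q^{2n-2-2i}\theta Y_{2n-2i}L_{2i+1},$$ $$[L_{2n}',Y_1]=\sum_{i=0}^{n-1}Q_{2n-1-2i}\,\theta Y_{2n+1-2i}L_{2i}'+\sum_{i=0}^{n-1}Q_{2n-2-2i}\,\theta Y_{2n-2i}L_{2i+1}',$$ $$[L_{2n},Y_2]=\sum_{i=0}^{n-1}P_{2n-1-2i}\,\theta Y_{2n+2-2i}L_{2i}-\sum_{i=0}^{n-1}P_{2n-2-2i}\,\theta Y_{2n+1-2i}L_{2i+1},$$ $$[L_{2n}',Y_2]=\sum_{i=0}^{n-1}q^{2n-1-2i}\theta Y_{2n+2-2i}L_{2i}'-\sum_{i=0}^{n-1}q^{2n-2-2i}\theta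 Y_{2n+1-2i}L_{2i+1}'.$$ -/

import Mathlib

open scoped TensorProduct

namespace DiagonalNichols

noncomputable section

/-! ### Braided vector spaces of diagonal type and their Nichols algebras

`V` has the basis `(x_i)_{i : ι}` and the braiding `c (x_i ⊗ x_j) = Q i j • x_j ⊗ x_i`.
The tensor algebra `T(V)` is the free algebra on the letters `x_i`; the words form a basis. -/

section General

variable {ι : Type} [Fintype ι] [DecidableEq ι]

/-- The word `w`, as an element of `T(V)`. -/
def word (w : List ι) : FreeAlgebra ℂ ι := (w.map (FreeAlgebra.ι ℂ)).prod

/-- The degree of a word in `ℕ^ι`: the number of occurrences of every letter. -/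
def wordDegree (w : List ι) : ι → ℕ := fun i => w.count i

/-- The bicharacter with `χ(α_i, α_j) = Q i j`. -/
def bichar (Q : Matrix ι ι ℂ) (a b : ι → ℕ) : ℂ := ∏ i, ∏ j, Q i j ^ (a i * b j)

/-- The braiding of `T(V)`: `c (u ⊗ v) = χ(deg u, deg v) • v ⊗ u` for words `u`, `v`. -/
def braiding (Q : Matrix ι ι ℂ) :
    FreeAlgebra ℂ ι ⊗[ℂ] FreeAlgebra ℂ ι →ₗ[ℂ] FreeAlgebra ℂ ι ⊗[ℂ] FreeAlgebra ℂ ι :=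
  ((FreeAlgebra.basisFreeMonoid ℂ ι).tensorProduct (FreeAlgebra.basisFreeMonoid ℂ ι)).constr ℂ
    fun p => bichar Q (wordDegree p.1.toList) (wordDegree p.2.toList) •
      (word p.2.toList ⊗ₜ[ℂ] word p.1.toList)

/-- The braided bracket `[x, y] = m ∘ (id - c) (x ⊗ y)` on `T(V)`. -/
def bracket (Q : Matrix ι ι ℂ) (x y : FreeAlgebra ℂ ι) : FreeAlgebra ℂ ι :=
  LinearMap.mul' ℂ (FreeAlgebra ℂ ι) (x ⊗ₜ[ℂ] y - braiding Q (x ⊗ₜ[ℂ] y))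

/-- The image of a word under the quantum symmetrizer `𝔖_n = ∑_{σ ∈ S_n} c_σ`, where `n` is the
length of the word and `c_σ` is the action of the Matsumoto lift of the permutation to the braid
group `B_n` on `V^{⊗ n}`. For a diagonal braiding this lift rearranges the letters, with one
factor `Q i j` for every pair of letters `i` (originally left) and `j` (originally right) whose
relative order is reversed. Here the `k`-th letter of the new word is the `σ k`-th of the old. -/
def symmetrizeWord (Q : Matrix ι ι ℂ) (w : List ι) : FreeAlgebra ℂ ι :=
  ∑ σ : Equiv.Perm (Fin w.length),
    (∏ a : Fin w.length, ∏ b : Fin w.length,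
      if a < b ∧ σ b < σ a then Q (w.get (σ b)) (w.get (σ a)) else 1) •
    word (List.ofFn fun k => w.get (σ k))

/-- The quantum symmetrizer `𝔖 = ⨁_n 𝔖_n` on `T(V) = ⨁_n V^{⊗ n}`. -/
def quantumSymmetrizer (Q : Matrix ι ι ℂ) : FreeAlgebra ℂ ι →ₗ[ℂ] FreeAlgebra ℂ ι :=
  (FreeAlgebra.basisFreeMonoid ℂ ι).constr ℂ fun w => symmetrizeWord Q w.toList

/-- The Nichols algebra `B(V) = T(V) / ⨁_n ker 𝔖_n`. -/
abbrev NicholsAlgebra (Q : Matrix ι ι ℂ) : Type :=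
  RingQuot fun x y : FreeAlgebra ℂ ι => quantumSymmetrizer Q x = 0 ∧ y = 0

/-- The canonical projection `T(V) → B(V)`. -/
def toNichols (Q : Matrix ι ι ℂ) : FreeAlgebra ℂ ι →ₐ[ℂ] NicholsAlgebra Q :=
  RingQuot.mkAlgHom ℂ _

end General

/-! ### Lyndon words and super-letters -/

section Lyndon

variable {ι : Type} [Fintype ι] [DecidableEq ι] [LT ι]

/-- A nonempty word is Lyndon if it is lexicographically smaller than each of its proper nonempty
suffixes. -/
def IsLyndon (u : List ι) : Prop :=
  u ≠ [] ∧ ∀ v w : List ι, v ≠ [] → w ≠ [] → u = v ++ w → u < w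

/-- Cutting the word `u` after `k` letters gives two Lyndon words. -/
def IsLyndonCut (u : List ι) (k : ℕ) : Prop :=
  0 < k ∧ k < u.length ∧ IsLyndon (u.take k) ∧ IsLyndon (u.drop k)

open Classical in
/-- The super-letter `[u] ∈ T(V)` of a Lyndon word `u`: `[u] = u` for a letter, and otherwise
`[u] = [[v], [w]]`, where `u = v w` is the Shirshov decomposition, that is the decomposition into
two Lyndon words with `v` as short as possible. -/
def superLetter (Q : Matrix ι ι ℂ) (u : List ι) : FreeAlgebra ℂ ι :=
  if h : ∃ k, IsLyndonCut u k then
    bracket Q (superLetter Q (u.take (Nat.find h))) (superLetter Q (u.drop (Nat.find h)))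
  else word u
termination_by u.length
decreasing_by
  · have := Nat.find_spec h
    simp only [List.length_take]
    exact lt_of_le_of_lt (min_le_left _ _) this.2.1
  · have := Nat.find_spec h
    simp only [List.length_drop]
    have h1 := this.1
    have h2 := this.2.1
    omega

end Lyndon

/-! ### The braided vector space of rank two and its root vectors

The letters `x_1`, `x_2` are `0`, `1 : Fin 2`. -/

/-- The braiding matrix. -/
def braidingMatrix (q : ℂ) : Matrix (Fin 2) (Fin 2) ℂ := !![q, q⁻¹; q⁻¹, -q]

/-- `θ = q - q⁻¹`. -/
def theta (q : ℂ) : ℂ := q - q⁻¹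

/-- The word `(x_1 x_2)^n`. -/
def deltaWord (n : ℕ) : List (Fin 2) := (List.replicate n [0, 1]).flatten

/-- `X_n`, for `n ≥ 1`: the super-letter of `x_1 (x_1 x_2)^{n-1}`. -/
def rootX (q : ℂ) (n : ℕ) : FreeAlgebra ℂ (Fin 2) :=
  superLetter (braidingMatrix q) (0 :: deltaWord (n - 1))

/-- `Y_n`, for `n ≥ 1`: the super-letter of `(x_1 x_2)^{n-1} x_2`. -/
def rootY (q : ℂ) (n : ℕ) : FreeAlgebra ℂ (Fin 2) :=
  superLetter (braidingMatrix q) (deltaWord (n - 1) ++ [1])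

/-- `L_0 = 1/θ` and `L_n = [X_1, Y_n]` for `n ≥ 1`. -/
def rootL (q : ℂ) : ℕ → FreeAlgebra ℂ (Fin 2)
  | 0 => algebraMap ℂ _ (1 / theta q)
  | n + 1 => bracket (braidingMatrix q) (rootX q 1) (rootY q (n + 1))

/-- `L'_0 = 1/θ`, `L'_1 = L_1` and `L'_n = [X_2, Y_{n-1}]` for `n ≥ 2`. -/
def rootL' (q : ℂ) : ℕ → FreeAlgebra ℂ (Fin 2)
  | 0 => algebraMap ℂ _ (1 / theta q)
  | 1 => bracket (braidingMatrix q) (rootX q 1) (rootY q 1)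
  | n + 2 => bracket (braidingMatrix q) (rootX q 2) (rootY q (n + 1))

/-- `P_0 = 1` and `P_n = q^n + q^{n-1} + (-1)^{n-1} P_{n-1}`. -/
def polyP (q : ℂ) : ℕ → ℂ
  | 0 => 1
  | n + 1 => q ^ (n + 1) + q ^ n + (-1) ^ n * polyP q n

/-- `Q_0 = 1` and `Q_n = q^n - q^{n-1} + (-1)^n Q_{n-1}`. -/
def polyQ (q : ℂ) : ℕ → ℂ
  | 0 => 1
  | n + 1 => q ^ (n + 1) - q ^ n + (-1) ^ (n + 1) * polyQ q n

/-- The projection onto the Nichols algebra `B(𝕍)`. -/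
def toB (q : ℂ) : FreeAlgebra ℂ (Fin 2) →ₐ[ℂ] NicholsAlgebra (braidingMatrix q) :=
  toNichols (braidingMatrix q)

/-- The braided bracket of `𝕍`. -/
def br (q : ℂ) (x y : FreeAlgebra ℂ (Fin 2)) : FreeAlgebra ℂ (Fin 2) :=
  bracket (braidingMatrix q) x y

end

end DiagonalNichols

namespace DiagonalNichols

noncomputable section

/-! ### Skew derivations of the tensor algebra and the quotient they define -/

section SkewDerivations

set_option linter.unusedSectionVars false

variable {ι : Type} [DecidableEq ι]

/-! The quantum symmetrizer satisfies 𝔖(u) = ε(u) + Σ 𝔖(∂_i u) x_i with ε the augmentation and ∂_i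
the right skew derivations (`quantumSymmetrizer_eq`). Hence two tensors whose iterated skew
derivatives have the same constant terms agree in the Nichols algebra, and all computations may take
place in `DerQuotient`, where an element with zero constant term vanishes once every ∂_i kills it.
There the quantum Serre relations X₁X₂ = qX₂X₁ and Y₂Y₁ = qY₁Y₂ hold, and the Shirshov
decompositions give X_{n+2} = [X_{n+1}, L₁] and Y_{n+2} = [L₁, Y_{n+1}]. `RootVectors` records these
facts; the remaining algebra takes place in an abstract ring.

The central point is that L₁² commutes with every L_n (`commute_L`), hence with every L'_n. The
commutator Δ = [·, L₁²] is an ordinary derivation with ΔX_n = X_{n+2} and ΔY_n = -Y_{n+2}. Since Δ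
kills the L's, the bracket of X_a and Y_b depends only on a + b and the parity of a: it is L_{a+b-1}
for odd a and L'_{a+b-1} for even a (`pairing_odd`, `pairing_even`).

The commutation is proved by induction on the index: ∂₂ of [L₁², L_{k+1}] reduces to a relation
between X₂ and L_{k+1}, which follows from X₂X₃ = qX₃X₂ and the commutation in lower index. The
relation for X₂ and X₃, and its mirror for Y, come from commuting the Serre relations with L₂ or
L'₂. This requires the brackets of X₂ with L₂ and of L'₂ with Y₂, obtained from the relation
`L_three_add_L'_three`. Here one divides by 1 + q + q⁻¹, q + q⁻¹ - 1 and q + q⁻¹, which is where q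
must avoid certain roots of unity.

A q-commutation of two root vectors of one kind becomes, after bracketing with one of the other
kind, a relation between root vectors and L's (`left_pairing_comm`, `right_pairing_comm`).
Neighbouring root vectors give F_{m+1} = q²ΔF_m + two explicit terms, which unrolls to powers of q
(`closed_form_pow`). Root vectors two steps apart q-commute up to a square, which couples two
sequences; P and Q solve the coupled recursion (`closed_form_polyP`), the Q-relations being obtained
by replacing q with -q. -/

theorem basisFreeMonoid_apply (w : FreeMonoid ι) :
    FreeAlgebra.basisFreeMonoid ℂ ι w = word w.toList := by
  simp [FreeAlgebra.basisFreeMonoid, word, FreeAlgebra.equivMonoidAlgebraFreeMonoid,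
    FreeMonoid.lift_apply]

theorem linearMap_ext_word {M : Type*} [AddCommMonoid M] [Module ℂ M]
    {f g : FreeAlgebra ℂ ι →ₗ[ℂ] M} (h : ∀ w : List ι, f (word w) = g (word w)) : f = g :=
  (FreeAlgebra.basisFreeMonoid ℂ ι).ext fun w => by
    rw [basisFreeMonoid_apply]; exact h _

theorem quantumSymmetrizer_word (Q : Matrix ι ι ℂ) (w : List ι) :
    quantumSymmetrizer Q (word w) = symmetrizeWord Q w := by
  have h := (FreeAlgebra.basisFreeMonoid ℂ ι).constr_basis ℂ
    (fun w => symmetrizeWord Q w.toList) (FreeMonoid.ofList w)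
  rwa [basisFreeMonoid_apply] at h

/-- The automorphism `x_j ↦ Q i j x_j` of `T(V)`. -/
def twist (Q : Matrix ι ι ℂ) (i : ι) : FreeAlgebra ℂ ι →ₐ[ℂ] FreeAlgebra ℂ ι :=
  FreeAlgebra.lift ℂ fun j => Q i j • FreeAlgebra.ι ℂ j

/-- The skew derivation of `T(V)` and its twist, arranged in a triangular matrix. -/
def skewMatrix (Q : Matrix ι ι ℂ) (i : ι) :
    FreeAlgebra ℂ ι →ₐ[ℂ] Matrix (Fin 2) (Fin 2) (FreeAlgebra ℂ ι) :=
  FreeAlgebra.lift ℂ fun j =>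
    !![FreeAlgebra.ι ℂ j, if i = j then 1 else 0; 0, Q i j • FreeAlgebra.ι ℂ j]

/-- The right skew derivation `∂_i` of `T(V)`. -/
def skewDer (Q : Matrix ι ι ℂ) (i : ι) : FreeAlgebra ℂ ι →ₗ[ℂ] FreeAlgebra ℂ ι where
  toFun u := skewMatrix Q i u 0 1
  map_add' u v := by simp
  map_smul' c u := by simp

variable (Q : Matrix ι ι ℂ) (i : ι)

theorem twist_ι (j : ι) : twist Q i (FreeAlgebra.ι ℂ j) = Q i j • FreeAlgebra.ι ℂ j := by
  simp [twist]

/-- For upper triangular matrices with diagonal (u, t(u)), multiplicativity of the corner entry is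
exactly the twisted Leibniz rule, so the derivation exists because the free algebra maps to such
matrices. -/
theorem skewMatrix_entries (u : FreeAlgebra ℂ ι) :
    skewMatrix Q i u 0 0 = u ∧ skewMatrix Q i u 1 0 = 0 ∧ skewMatrix Q i u 1 1 = twist Q i u := by
  induction u using FreeAlgebra.induction with
  | grade0 r => simp [Matrix.algebraMap_matrix_apply]
  | grade1 x => simp [skewMatrix, twist]
  | mul a b ha hb =>
    obtain ⟨ha1, ha2, ha3⟩ := ha
    obtain ⟨hb1, hb2, hb3⟩ := hb
    simp [Matrix.mul_apply, *]
  | add a b ha hb =>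
    obtain ⟨ha1, ha2, ha3⟩ := ha
    obtain ⟨hb1, hb2, hb3⟩ := hb
    simp [*]

theorem skewDer_mul (u v : FreeAlgebra ℂ ι) :
    skewDer Q i (u * v) = u * skewDer Q i v + skewDer Q i u * twist Q i v := by
  have hu := skewMatrix_entries Q i u
  have hv := skewMatrix_entries Q i v
  simp [skewDer, Matrix.mul_apply, hu.1, hv.2.2]

theorem skewDer_ι (j : ι) : skewDer Q i (FreeAlgebra.ι ℂ j) = if i = j then 1 else 0 := by
  simp [skewDer, skewMatrix]

theorem skewDer_algebraMap (r : ℂ) : skewDer Q i (algebraMap ℂ _ r) = 0 := by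
  simp [skewDer, Matrix.algebraMap_matrix_apply]

theorem skewDer_one : skewDer Q i 1 = 0 := by
  simpa using skewDer_algebraMap Q i 1

theorem skewDer_twist (j : ι) (u : FreeAlgebra ℂ ι) :
    skewDer Q i (twist Q j u) = Q j i • twist Q j (skewDer Q i u) := by
  induction u using FreeAlgebra.induction with
  | grade0 r => simp [skewDer_algebraMap]
  | grade1 x =>
    rw [twist_ι, map_smul, skewDer_ι]
    split_ifs with h
    · subst h; simp
    · simp
  | mul a b ha hb =>
    have hc : ∀ u : FreeAlgebra ℂ ι, twist Q i (twist Q j u) = twist Q j (twist Q i u) := by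
      intro u
      have : (twist Q i).comp (twist Q j) = (twist Q j).comp (twist Q i) := by
        ext k
        simp [twist_ι, smul_smul, mul_comm]
      exact DFunLike.congr_fun this u
    rw [map_mul, skewDer_mul, ha, hb, skewDer_mul, map_add, map_mul, map_mul, smul_add, hc,
      mul_smul_comm, smul_mul_assoc]
  | add a b ha hb => simp [ha, hb]

/-- The augmentation of `T(V)`. -/
abbrev counit : FreeAlgebra ℂ ι →ₐ[ℂ] ℂ := FreeAlgebra.algebraMapInv

theorem counit_ι (j : ι) : counit (FreeAlgebra.ι ℂ j) = 0 := by
  simp [counit, FreeAlgebra.algebraMapInv]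

theorem counit_twist (u : FreeAlgebra ℂ ι) : counit (twist Q i u) = counit u := by
  have : counit.comp (twist Q i) = counit := by
    ext k
    simp [twist_ι, counit_ι]
  exact DFunLike.congr_fun this u

/-- The iterated skew derivation along a word. -/
def iterSkewDer : List ι → (FreeAlgebra ℂ ι →ₗ[ℂ] FreeAlgebra ℂ ι)
  | [] => LinearMap.id
  | i :: I => (iterSkewDer I).comp (skewDer Q i)

/-- Both terms of the Leibniz rule keep a left factor of the same type, so induction on the word
applies. With its right-hand counterpart, which also needs stability under the twists, this makes
such elements a two-sided ideal. -/
theorem counit_iterSkewDer_mul_of_left (I : List ι) :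
    ∀ u v : FreeAlgebra ℂ ι, (∀ J, counit (iterSkewDer Q J u) = 0) →
      counit (iterSkewDer Q I (u * v)) = 0 := by
  induction I with
  | nil => intro u v hu; have := hu []; simp_all [iterSkewDer]
  | cons i I ih =>
    intro u v hu
    have h1 := ih u (skewDer Q i v) hu
    have h2 := ih (skewDer Q i u) (twist Q i v) fun J => hu (i :: J)
    simp [iterSkewDer, skewDer_mul, h1, h2]

theorem counit_iterSkewDer_twist (I : List ι) :
    ∀ u : FreeAlgebra ℂ ι, (∀ J, counit (iterSkewDer Q J u) = 0) →
      counit (iterSkewDer Q I (twist Q i u)) = 0 := by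
  induction I with
  | nil => intro u hu; have := hu []; simp_all [iterSkewDer, counit_twist]
  | cons j I ih =>
    intro u hu
    have h1 := ih (skewDer Q j u) fun J => hu (j :: J)
    simp [iterSkewDer, skewDer_twist, h1]

theorem counit_iterSkewDer_mul_of_right (I : List ι) :
    ∀ u v : FreeAlgebra ℂ ι, (∀ J, counit (iterSkewDer Q J v) = 0) →
      counit (iterSkewDer Q I (u * v)) = 0 := by
  induction I with
  | nil => intro u v hv; have := hv []; simp_all [iterSkewDer]
  | cons i I ih =>
    intro u v hv
    have h1 := ih u (skewDer Q i v) fun J => hv (i :: J)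
    have h2 := ih (skewDer Q i u) (twist Q i v) fun J => counit_iterSkewDer_twist Q i J v hv
    simp [iterSkewDer, skewDer_mul, h1, h2]

/-- Two elements of `T(V)` are congruent if all their iterated skew derivatives have the same
constant term. -/
def derCon : RingCon (FreeAlgebra ℂ ι) where
  r u v := ∀ I, counit (iterSkewDer Q I u) = counit (iterSkewDer Q I v)
  iseqv := ⟨fun _ _ => rfl, fun h I => (h I).symm, fun h k I => (h I).trans (k I)⟩
  add' h k I := by simp [h I, k I]
  mul' {a b c d} h k I := by
    have h' : ∀ J, counit (iterSkewDer Q J (a - b)) = 0 := fun J => by simp [h J]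
    have k' : ∀ J, counit (iterSkewDer Q J (c - d)) = 0 := fun J => by simp [k J]
    have h1 := counit_iterSkewDer_mul_of_left Q I _ c h'
    have h2 := counit_iterSkewDer_mul_of_right Q I b _ k'
    have : a * c = b * d + ((a - b) * c + b * (c - d)) := by noncomm_ring
    rw [this, map_add, map_add, map_add, map_add, h1, h2]
    simp

/-- The quotient of `T(V)` by the congruence defined by the skew derivations. -/
abbrev DerQuotient : Type := (derCon Q).Quotient

/-- The projection of `T(V)` onto the quotient. -/
abbrev toDer : FreeAlgebra ℂ ι →ₐ[ℂ] DerQuotient Q := (derCon Q).mkₐ (α := ℂ)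

theorem toDer_eq_iff (u v : FreeAlgebra ℂ ι) :
    toDer Q u = toDer Q v ↔ ∀ I, counit (iterSkewDer Q I u) = counit (iterSkewDer Q I v) :=
  RingCon.eq (derCon Q)

theorem toDer_surjective : Function.Surjective (toDer Q) := RingCon.mkₐ_surjective (derCon Q)

theorem toDer_skewDer_congr {u v : FreeAlgebra ℂ ι} (h : toDer Q u = toDer Q v) :
    toDer Q (skewDer Q i u) = toDer Q (skewDer Q i v) := by
  rw [toDer_eq_iff] at h ⊢
  exact fun I => h (i :: I)

theorem toDer_twist_congr {u v : FreeAlgebra ℂ ι} (h : toDer Q u = toDer Q v) :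
    toDer Q (twist Q i u) = toDer Q (twist Q i v) := by
  rw [toDer_eq_iff] at h ⊢
  intro I
  have := counit_iterSkewDer_twist Q i I (u - v) fun J => by simp [h J]
  simpa [sub_eq_zero] using this

/-- The right inverse of the projection used to transport operators to the quotient. -/
def derLift (a : DerQuotient Q) : FreeAlgebra ℂ ι := (toDer_surjective Q a).choose

theorem toDer_derLift (a : DerQuotient Q) : toDer Q (derLift Q a) = a :=
  (toDer_surjective Q a).choose_spec

/-- The skew derivation on the quotient. -/
def skewDerQ : DerQuotient Q →ₗ[ℂ] DerQuotient Q where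
  toFun a := toDer Q (skewDer Q i (derLift Q a))
  map_add' a b := by
    rw [← map_add, ← map_add]
    exact toDer_skewDer_congr Q i (by simp only [map_add, toDer_derLift])
  map_smul' c a := by
    rw [RingHom.id_apply, ← map_smul, ← map_smul]
    exact toDer_skewDer_congr Q i (by simp only [map_smul, toDer_derLift])

theorem skewDerQ_toDer (u : FreeAlgebra ℂ ι) :
    skewDerQ Q i (toDer Q u) = toDer Q (skewDer Q i u) :=
  toDer_skewDer_congr Q i (toDer_derLift Q _)

/-- The twist on the quotient. -/
def twistQ : DerQuotient Q →ₗ[ℂ] DerQuotient Q where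
  toFun a := toDer Q (twist Q i (derLift Q a))
  map_add' a b := by
    rw [← map_add, ← map_add]
    exact toDer_twist_congr Q i (by simp only [map_add, toDer_derLift])
  map_smul' c a := by
    rw [RingHom.id_apply, ← map_smul, ← map_smul]
    exact toDer_twist_congr Q i (by simp only [map_smul, toDer_derLift])

theorem twistQ_toDer (u : FreeAlgebra ℂ ι) :
    twistQ Q i (toDer Q u) = toDer Q (twist Q i u) :=
  toDer_twist_congr Q i (toDer_derLift Q _)

theorem twistQ_mul (a b : DerQuotient Q) :
    twistQ Q i (a * b) = twistQ Q i a * twistQ Q i b := by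
  obtain ⟨u, rfl⟩ := toDer_surjective Q a
  obtain ⟨v, rfl⟩ := toDer_surjective Q b
  simp only [← map_mul, twistQ_toDer]

theorem skewDerQ_mul (a b : DerQuotient Q) :
    skewDerQ Q i (a * b) = a * skewDerQ Q i b + skewDerQ Q i a * twistQ Q i b := by
  obtain ⟨u, rfl⟩ := toDer_surjective Q a
  obtain ⟨v, rfl⟩ := toDer_surjective Q b
  simp only [← map_mul, twistQ_toDer, skewDerQ_toDer, skewDer_mul, map_add]

/-- The criterion by which relations are proved: every nonempty iterated derivative factors through
a first derivative. -/
theorem toDer_eq_zero (u : FreeAlgebra ℂ ι) (h0 : counit u = 0)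
    (h : ∀ i, skewDerQ Q i (toDer Q u) = 0) : toDer Q u = 0 := by
  rw [← map_zero (toDer Q), toDer_eq_iff]
  intro I
  cases I with
  | nil => simpa [iterSkewDer] using h0
  | cons i I =>
    have := h i
    rw [skewDerQ_toDer, ← map_zero (toDer Q), toDer_eq_iff] at this
    simpa [iterSkewDer] using this I

end SkewDerivations

end

end DiagonalNichols

namespace DiagonalNichols

noncomputable section

/-! ### The quantum symmetrizer in terms of skew derivations -/

section Symmetrizer

set_option linter.unusedSectionVars false

variable {ι : Type} [DecidableEq ι] (Q : Matrix ι ι ℂ)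

/-- The quantum symmetrizer on the word with letters `f 0, …, f (n - 1)`. -/
def symmetrizeFun {n : ℕ} (f : Fin n → ι) : FreeAlgebra ℂ ι :=
  ∑ σ : Equiv.Perm (Fin n),
    (∏ a : Fin n, ∏ b : Fin n, if a < b ∧ σ b < σ a then Q (f (σ b)) (f (σ a)) else 1) •
    word (List.ofFn fun k => f (σ k))

theorem symmetrizeWord_ofFn {n : ℕ} (f : Fin n → ι) :
    symmetrizeWord Q (List.ofFn f) = symmetrizeFun Q f := by
  have key : ∀ (w : List ι) (h : w.length = n), (∀ k, w.get k = f (Fin.cast h k)) →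
      symmetrizeFun Q w.get = symmetrizeFun Q f := by
    intro w h
    subst h
    intro hk
    congr 1
    ext k
    exact hk k
  exact key _ (List.length_ofFn) fun k => by simp [Fin.cast]

/-- The permutation of `Fin (n + 1)` sending the last element to `k` and acting on the others
as `τ`. -/
def permOfLast {n : ℕ} (p : Fin (n + 1) × Equiv.Perm (Fin n)) : Equiv.Perm (Fin (n + 1)) :=
  ((finSuccEquiv' (Fin.last n)).trans (Equiv.optionCongr p.2)).trans (finSuccEquiv' p.1).symm

theorem permOfLast_last {n : ℕ} (p : Fin (n + 1) × Equiv.Perm (Fin n)) :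
    permOfLast p (Fin.last n) = p.1 := by
  simp [permOfLast]

theorem permOfLast_castSucc {n : ℕ} (p : Fin (n + 1) × Equiv.Perm (Fin n)) (a : Fin n) :
    permOfLast p a.castSucc = p.1.succAbove (p.2 a) := by
  simp [permOfLast, finSuccEquiv'_last_apply_castSucc]

theorem permOfLast_bijective {n : ℕ} :
    Function.Bijective (permOfLast : Fin (n + 1) × Equiv.Perm (Fin n) → _) := by
  rw [Fintype.bijective_iff_injective_and_card]
  constructor
  · rintro ⟨k, τ⟩ ⟨l, ρ⟩ h
    have h1 : k = l := by
      simpa [permOfLast_last] using DFunLike.congr_fun h (Fin.last n)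
    subst h1
    congr 1
    ext a
    have := DFunLike.congr_fun h a.castSucc
    simp only [permOfLast_castSucc] at this
    rw [Fin.succAbove_right_injective this]
  · simp [Fintype.card_perm, Nat.factorial_succ]

theorem word_ofFn_castSucc {n : ℕ} (f : Fin (n + 1) → ι) :
    word (List.ofFn f) =
      word (List.ofFn fun k => f k.castSucc) * FreeAlgebra.ι ℂ (f (Fin.last n)) := by
  rw [List.ofFn_succ']
  simp [word]

theorem word_ofFn_succ {n : ℕ} (f : Fin (n + 1) → ι) :
    word (List.ofFn f) =
      FreeAlgebra.ι ℂ (f 0) * word (List.ofFn fun k => f k.succ) := by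
  rw [List.ofFn_succ]
  simp [word]

/-- Permutations are sorted by the old position k of the letter that ends up last. Inversions among
the other positions are those of the smaller permutation; the remaining ones are the letters to the
right of k that the letter at k must cross. -/
theorem symmetrizeFun_succ {n : ℕ} (f : Fin (n + 1) → ι) :
    symmetrizeFun Q f = ∑ k : Fin (n + 1),
      (∏ l : Fin n, if k < k.succAbove l then Q (f k) (f (k.succAbove l)) else 1) •
        (symmetrizeFun Q (fun l => f (k.succAbove l)) * FreeAlgebra.ι ℂ (f k)) := by
  unfold symmetrizeFun
  rw [← (permOfLast_bijective (n := n)).sum_comp, Fintype.sum_prod_type]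
  refine Finset.sum_congr rfl fun k _ => ?_
  rw [Finset.sum_mul, Finset.smul_sum]
  refine Finset.sum_congr rfl fun τ _ => ?_
  rw [word_ofFn_castSucc, smul_mul_assoc, smul_smul]
  simp only [permOfLast_last, permOfLast_castSucc]
  congr 1
  rw [Fin.prod_univ_castSucc]
  simp only [Fin.prod_univ_castSucc (n := n), permOfLast_last, permOfLast_castSucc,
    Fin.castSucc_lt_castSucc_iff, Fin.castSucc_lt_last, true_and, false_and,
    if_false, mul_one, not_lt.mpr (Fin.le_last _), Finset.prod_const_one, Finset.prod_mul_distrib,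
    Fin.succAbove_lt_succAbove_iff]
  rw [mul_comm]
  congr 1
  exact Equiv.prod_comp τ fun l => if k < k.succAbove l then Q (f k) (f (k.succAbove l)) else 1

theorem twist_word_ofFn (i : ι) {n : ℕ} (f : Fin n → ι) :
    twist Q i (word (List.ofFn f)) = (∏ l, Q i (f l)) • word (List.ofFn f) := by
  induction n with
  | zero => simp [word]
  | succ n ih =>
    rw [word_ofFn_succ, map_mul, ih, twist_ι, Fin.prod_univ_succ, smul_mul_smul_comm]

theorem skewDer_word_ofFn (i : ι) {n : ℕ} (f : Fin (n + 1) → ι) :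
    skewDer Q i (word (List.ofFn f)) = ∑ k : Fin (n + 1), if i = f k then
      (∏ l : Fin n, if k < k.succAbove l then Q i (f (k.succAbove l)) else 1) •
        word (List.ofFn fun l => f (k.succAbove l)) else 0 := by
  induction n with
  | zero =>
    rw [Fin.sum_univ_succ]
    simp [word, skewDer_ι]
  | succ n ih =>
    rw [word_ofFn_succ, skewDer_mul, skewDer_ι, twist_word_ofFn, ih, add_comm]
    conv_rhs => rw [Fin.sum_univ_succ]
    congr 1
    · simp [ite_mul]
    · rw [Finset.mul_sum]
      refine Finset.sum_congr rfl fun k _ => ?_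
      rw [Fin.prod_univ_succ, word_ofFn_succ]
      simp [Fin.succ_succAbove_succ, mul_ite]

/-- Deleting the letter at position k in a skew derivative costs the same product of braiding
coefficients as moving it to the end in `symmetrizeFun_succ`. -/
theorem quantumSymmetrizer_eq [Fintype ι] (u : FreeAlgebra ℂ ι) :
    quantumSymmetrizer Q u = counit u • 1 +
      ∑ i, quantumSymmetrizer Q (skewDer Q i u) * FreeAlgebra.ι ℂ i := by
  have : quantumSymmetrizer Q = (LinearMap.toSpanSingleton ℂ _ 1).comp counit.toLinearMap +
      ∑ i, (LinearMap.mulRight ℂ (FreeAlgebra.ι ℂ i)).comp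
        ((quantumSymmetrizer Q).comp (skewDer Q i)) := by
    apply linearMap_ext_word
    intro w
    obtain ⟨n, f, rfl⟩ : ∃ (n : ℕ) (f : Fin n → ι), w = List.ofFn f :=
      ⟨_, w.get, (List.ofFn_get w).symm⟩
    cases n with
    | zero =>
      rw [quantumSymmetrizer_word, symmetrizeWord_ofFn]
      simp [symmetrizeFun, word, skewDer_one]
    | succ n =>
      have h0 : counit (word (List.ofFn f)) = 0 := by
        rw [word_ofFn_succ, map_mul, counit_ι, zero_mul]
      rw [quantumSymmetrizer_word, symmetrizeWord_ofFn, symmetrizeFun_succ]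
      simp only [LinearMap.add_apply, LinearMap.comp_apply, LinearMap.sum_apply,
        skewDer_word_ofFn, AlgHom.toLinearMap_apply, h0, map_zero, zero_add, map_sum,
        LinearMap.mulRight_apply]
      rw [Finset.sum_comm]
      refine Finset.sum_congr rfl fun k _ => ?_
      -- Position k contributes only to the derivative along its own letter.
      rw [Finset.sum_eq_single (f k)]
      · simp only [if_true, map_smul, quantumSymmetrizer_word, symmetrizeWord_ofFn,
          smul_mul_assoc]
      · intro j _ hj
        simp [hj]
      · simp
  conv_lhs => rw [this]
  simp [LinearMap.toSpanSingleton_apply]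

theorem skewDer_mem_span (i : ι) (n : ℕ) (u : FreeAlgebra ℂ ι)
    (hu : u ∈ Submodule.span ℂ (word '' {w : List ι | w.length ≤ n + 1})) :
    skewDer Q i u ∈ Submodule.span ℂ (word '' {w : List ι | w.length ≤ n}) := by
  induction hu using Submodule.span_induction with
  | zero => simp
  | add x y _ _ hx hy => rw [map_add]; exact add_mem hx hy
  | smul a x _ hx => rw [map_smul]; exact Submodule.smul_mem _ _ hx
  | mem x hx =>
    obtain ⟨w, hw, rfl⟩ := hx
    obtain ⟨m, f, rfl⟩ : ∃ (n : ℕ) (f : Fin n → ι), w = List.ofFn f :=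
      ⟨_, w.get, (List.ofFn_get w).symm⟩
    cases m with
    | zero => simp [word, skewDer_one]
    | succ m =>
      rw [skewDer_word_ofFn]
      refine Submodule.sum_mem _ fun k _ => ?_
      split_ifs
      · refine Submodule.smul_mem _ _ (Submodule.subset_span ⟨_, ?_, rfl⟩)
        simpa using hw
      · exact Submodule.zero_mem _

theorem exists_mem_span_word (u : FreeAlgebra ℂ ι) :
    ∃ n, u ∈ Submodule.span ℂ (word '' {w : List ι | w.length ≤ n}) := by
  induction (FreeAlgebra.basisFreeMonoid ℂ ι).mem_span u using Submodule.span_induction with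
  | zero => exact ⟨0, Submodule.zero_mem _⟩
  | mem u hu =>
    obtain ⟨w, rfl⟩ := hu
    rw [basisFreeMonoid_apply]
    exact ⟨_, Submodule.subset_span ⟨w.toList, Nat.le_refl _, rfl⟩⟩
  | add u v _ _ hu hv =>
    obtain ⟨m, hm⟩ := hu
    obtain ⟨n, hn⟩ := hv
    refine ⟨max m n, add_mem (Submodule.span_mono (Set.image_mono ?_) hm)
      (Submodule.span_mono (Set.image_mono ?_) hn)⟩
    · intro w hw; exact Nat.le_trans hw (le_max_left _ _)
    · intro w hw; exact Nat.le_trans hw (le_max_right _ _)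
  | smul c u _ hu =>
    obtain ⟨m, hm⟩ := hu
    exact ⟨m, Submodule.smul_mem _ _ hm⟩

/-- Induction on a bound for the word length, which each skew derivation lowers by one. -/
theorem quantumSymmetrizer_eq_zero [Fintype ι] (u : FreeAlgebra ℂ ι)
    (hu : ∀ I, counit (iterSkewDer Q I u) = 0) : quantumSymmetrizer Q u = 0 := by
  obtain ⟨n, hn⟩ := exists_mem_span_word u
  induction n generalizing u with
  | zero =>
    have hd : ∀ i, skewDer Q i u = 0 := fun i => by
      refine LinearMap.mem_ker.mp ((Submodule.span_le (p := LinearMap.ker (skewDer Q i))).mpr ?_ hn)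
      rintro _ ⟨w, hw, rfl⟩
      have : w = [] := List.length_eq_zero_iff.mp (Nat.le_zero.mp hw)
      simp [this, word, skewDer_one]
    rw [quantumSymmetrizer_eq]
    have := hu []
    simp_all [iterSkewDer]
  | succ n ih =>
    rw [quantumSymmetrizer_eq]
    have h0 := hu []
    have h1 : ∀ i, quantumSymmetrizer Q (skewDer Q i u) = 0 := fun i =>
      ih _ (fun I => hu (i :: I)) (skewDer_mem_span Q i n u hn)
    simp_all [iterSkewDer]

/-- Only this inclusion of kernels is needed: relations proved in the derivation quotient descend to
the Nichols algebra. -/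
theorem toNichols_eq_of_toDer_eq [Fintype ι] {u v : FreeAlgebra ℂ ι}
    (h : toDer Q u = toDer Q v) : toNichols Q u = toNichols Q v := by
  have h0 : quantumSymmetrizer Q (u - v) = 0 :=
    quantumSymmetrizer_eq_zero Q _ fun I => by
      rw [map_sub, map_sub, (toDer_eq_iff Q u v).mp h I, sub_self]
  have h1 : toNichols Q (u - v) = toNichols Q 0 := RingQuot.mkAlgHom_rel ℂ ⟨h0, rfl⟩
  rwa [map_sub, map_zero, sub_eq_zero] at h1

end Symmetrizer

end

end DiagonalNichols

namespace DiagonalNichols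

noncomputable section

/-! ### The braided bracket on homogeneous elements -/

section Bracket

set_option linter.unusedSectionVars false

variable {ι : Type} [Fintype ι] [DecidableEq ι] (Q : Matrix ι ι ℂ)

/-- The homogeneous elements of degree `a`. -/
def homogeneous (a : ι → ℕ) : Submodule ℂ (FreeAlgebra ℂ ι) :=
  Submodule.span ℂ (word '' {w : List ι | wordDegree w = a})

theorem bracket_add_left (u v w : FreeAlgebra ℂ ι) :
    bracket Q (u + v) w = bracket Q u w + bracket Q v w := by
  simp [bracket, TensorProduct.add_tmul]; abel

theorem bracket_add_right (u v w : FreeAlgebra ℂ ι) :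
    bracket Q u (v + w) = bracket Q u v + bracket Q u w := by
  simp [bracket, TensorProduct.tmul_add]; abel

theorem bracket_smul_left (c : ℂ) (u v : FreeAlgebra ℂ ι) :
    bracket Q (c • u) v = c • bracket Q u v := by
  rw [bracket, ← TensorProduct.smul_tmul', map_smul, map_sub, map_smul, map_smul, bracket,
    map_sub, smul_sub]

theorem bracket_smul_right (c : ℂ) (u v : FreeAlgebra ℂ ι) :
    bracket Q u (c • v) = c • bracket Q u v := by
  simp [bracket, TensorProduct.tmul_smul, smul_sub]

theorem bracket_word (v w : List ι) :
    bracket Q (word v) (word w) =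
      word v * word w - bichar Q (wordDegree v) (wordDegree w) • (word w * word v) := by
  have h := ((FreeAlgebra.basisFreeMonoid ℂ ι).tensorProduct
    (FreeAlgebra.basisFreeMonoid ℂ ι)).constr_basis ℂ
    (fun p => bichar Q (wordDegree p.1.toList) (wordDegree p.2.toList) •
      (word p.2.toList ⊗ₜ[ℂ] word p.1.toList)) (FreeMonoid.ofList v, FreeMonoid.ofList w)
  rw [Module.Basis.tensorProduct_apply, basisFreeMonoid_apply, basisFreeMonoid_apply] at h
  have h' : braiding Q (word v ⊗ₜ[ℂ] word w) =
    bichar Q (wordDegree v) (wordDegree w) • (word w ⊗ₜ[ℂ] word v) := h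
  simp [bracket, h']

theorem bracket_of_homogeneous {a b : ι → ℕ} {u v : FreeAlgebra ℂ ι} (hu : u ∈ homogeneous a)
    (hv : v ∈ homogeneous b) : bracket Q u v = u * v - bichar Q a b • (v * u) := by
  induction hu using Submodule.span_induction with
  | zero => simp [bracket]
  | add x y _ _ hx hy =>
    rw [bracket_add_left, hx, hy, add_mul, mul_add, smul_add]; abel
  | smul c x _ hx =>
    rw [bracket_smul_left, hx, smul_sub, smul_mul_assoc, mul_smul_comm, smul_comm c]
  | mem x hx =>
    obtain ⟨s, hs, rfl⟩ := hx
    induction hv using Submodule.span_induction with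
    | zero => simp [bracket]
    | add x y _ _ hx hy =>
      rw [bracket_add_right, hx, hy, add_mul, mul_add, smul_add]; abel
    | smul c x _ hx =>
      rw [bracket_smul_right, hx, smul_sub, smul_mul_assoc, mul_smul_comm, smul_comm c]
    | mem y hy =>
      obtain ⟨t, ht, rfl⟩ := hy
      rw [bracket_word, hs, ht]

theorem mul_mem_homogeneous {a b : ι → ℕ} {u v : FreeAlgebra ℂ ι} (hu : u ∈ homogeneous a)
    (hv : v ∈ homogeneous b) : u * v ∈ homogeneous (a + b) := by
  induction hu using Submodule.span_induction with
  | zero => simp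
  | add x y _ _ hx hy => rw [add_mul]; exact add_mem hx hy
  | smul c x _ hx => rw [smul_mul_assoc]; exact Submodule.smul_mem _ _ hx
  | mem x hx =>
    obtain ⟨s, hs, rfl⟩ := hx
    induction hv using Submodule.span_induction with
    | zero => simp
    | add x y _ _ hx hy => rw [mul_add]; exact add_mem hx hy
    | smul c x _ hx => rw [mul_smul_comm]; exact Submodule.smul_mem _ _ hx
    | mem y hy =>
      obtain ⟨t, ht, rfl⟩ := hy
      refine Submodule.subset_span ⟨s ++ t, ?_, by simp [word]⟩
      ext i
      rw [← hs, ← ht]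
      simp [wordDegree]

theorem bracket_mem_homogeneous {a b : ι → ℕ} {u v : FreeAlgebra ℂ ι} (hu : u ∈ homogeneous a)
    (hv : v ∈ homogeneous b) : bracket Q u v ∈ homogeneous (a + b) := by
  rw [bracket_of_homogeneous Q hu hv]
  refine sub_mem (mul_mem_homogeneous hu hv) (Submodule.smul_mem _ _ ?_)
  rw [add_comm]
  exact mul_mem_homogeneous hv hu

theorem word_mem_homogeneous (w : List ι) : word w ∈ homogeneous (wordDegree w) :=
  Submodule.subset_span ⟨w, rfl, rfl⟩

end Bracket

/-! ### Super-letters and Shirshov decompositions of the relevant Lyndon words -/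

section SuperLetters

set_option linter.unusedSectionVars false

variable {ι : Type} [Fintype ι] [DecidableEq ι] [LT ι] (Q : Matrix ι ι ℂ)

theorem superLetter_of_cut {u : List ι} {k : ℕ} (hk : IsLyndonCut u k)
    (hmin : ∀ j < k, ¬ IsLyndonCut u j) :
    superLetter Q u = bracket Q (superLetter Q (u.take k)) (superLetter Q (u.drop k)) := by
  classical
  have h : ∃ k, IsLyndonCut u k := ⟨k, hk⟩
  rw [superLetter, dif_pos h]
  have : ∀ m, m = k → bracket Q (superLetter Q (u.take m)) (superLetter Q (u.drop m)) =
    bracket Q (superLetter Q (u.take k)) (superLetter Q (u.drop k)) := by rintro _ rfl; rfl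
  exact this _ ((Nat.find_eq_iff h).mpr ⟨hk, fun j hj => hmin j hj⟩)

theorem superLetter_singleton (i : ι) : superLetter Q [i] = FreeAlgebra.ι ℂ i := by
  rw [superLetter, dif_neg]
  · simp [word]
  · rintro ⟨k, h1, h2, -⟩
    simp at h2
    omega

theorem not_isLyndon_of_append {v w : List ι} (hv : v ≠ []) (hw : w ≠ []) (h : ¬ v ++ w < w) :
    ¬ IsLyndon (v ++ w) := fun hl => h (hl.2 v w hv hw rfl)

end SuperLetters

section Words

theorem deltaWord_succ (n : ℕ) : deltaWord (n + 1) = 0 :: 1 :: deltaWord n := by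
  simp [deltaWord, List.replicate_succ]

theorem deltaWord_zero : deltaWord 0 = [] := rfl

theorem length_deltaWord (n : ℕ) : (deltaWord n).length = 2 * n := by
  simp [deltaWord, mul_comm]

theorem deltaWord_add (m n : ℕ) : deltaWord (m + n) = deltaWord m ++ deltaWord n := by
  rw [deltaWord, List.replicate_add, List.flatten_append]; rfl

theorem suffix_deltaWord {n : ℕ} {w : List (Fin 2)} (h : w <:+ deltaWord n) (hw : w ≠ []) :
    (∃ j, w = deltaWord (j + 1)) ∨ ∃ j, w = 1 :: deltaWord j := by
  induction n with
  | zero => simp [deltaWord_zero] at h; contradiction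
  | succ n ih =>
    rw [deltaWord_succ, List.suffix_cons_iff, List.suffix_cons_iff] at h
    rcases h with h | h | h
    · exact Or.inl ⟨n, by rw [h, deltaWord_succ]⟩
    · exact Or.inr ⟨n, h⟩
    · exact ih h

theorem suffix_deltaWord_append {n : ℕ} {w : List (Fin 2)} (h : w <:+ deltaWord n ++ [1])
    (hw : w ≠ []) :
    (∃ j ≤ n, w = deltaWord j ++ [1]) ∨ ∃ j < n, w = 1 :: (deltaWord j ++ [1]) := by
  induction n with
  | zero =>
    rw [deltaWord_zero, List.nil_append, List.suffix_cons_iff] at h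
    rcases h with h | h
    · exact Or.inl ⟨0, le_rfl, h⟩
    · simp at h; contradiction
  | succ n ih =>
    rw [deltaWord_succ, List.cons_append, List.cons_append, List.suffix_cons_iff,
      List.suffix_cons_iff] at h
    rcases h with h | h | h
    · exact Or.inl ⟨n + 1, le_rfl, by rw [h, deltaWord_succ]; rfl⟩
    · exact Or.inr ⟨n, Nat.lt_succ_self n, h⟩
    · rcases ih h with ⟨j, hj, h⟩ | ⟨j, hj, h⟩
      · exact Or.inl ⟨j, by omega, h⟩
      · exact Or.inr ⟨j, by omega, h⟩

theorem deltaWord_lt_one_cons (n : ℕ) (w : List (Fin 2)) : deltaWord n < 1 :: w := by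
  cases n with
  | zero => simp [deltaWord_zero]
  | succ n => simp [deltaWord_succ, List.cons_lt_cons_iff]

theorem isLyndon_zero_cons_deltaWord (n : ℕ) : IsLyndon (0 :: deltaWord n) := by
  refine ⟨by simp, fun v w hv hw h => ?_⟩
  obtain ⟨a, v, rfl⟩ := List.exists_cons_of_ne_nil hv
  obtain ⟨-, h2⟩ := List.cons.inj h
  rcases suffix_deltaWord ⟨v, h2.symm⟩ hw with ⟨j, rfl⟩ | ⟨j, rfl⟩
  · rw [deltaWord_succ, List.cons_lt_cons_iff]
    exact Or.inr ⟨rfl, deltaWord_lt_one_cons _ _⟩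
  · simp [List.cons_lt_cons_iff]

theorem deltaWord_append_lt {m n : ℕ} (h : m < n) : deltaWord n ++ [1] < deltaWord m ++ [1] := by
  induction m generalizing n with
  | zero =>
    obtain ⟨n, rfl⟩ := Nat.exists_eq_add_of_lt h
    rw [Nat.zero_add, deltaWord_succ]
    simp [deltaWord_zero, List.cons_lt_cons_iff]
  | succ m ih =>
    obtain ⟨n, rfl⟩ : ∃ k, n = k + 1 := ⟨n - 1, by omega⟩
    simpa [deltaWord_succ, List.cons_lt_cons_iff] using ih (Nat.lt_of_succ_lt_succ h)

theorem isLyndon_deltaWord_append (n : ℕ) : IsLyndon (deltaWord n ++ [1]) := by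
  refine ⟨by simp, fun v w hv hw h => ?_⟩
  have hlen := congrArg List.length h
  have hvl := List.length_pos_iff.mpr hv
  simp only [List.length_append, length_deltaWord, List.length_singleton] at hlen
  rcases suffix_deltaWord_append ⟨v, h.symm⟩ hw with ⟨j, hj, rfl⟩ | ⟨j, hj, rfl⟩
  · apply deltaWord_append_lt
    simp only [List.length_append, length_deltaWord, List.length_singleton] at hlen
    omega
  · obtain ⟨n, rfl⟩ : ∃ k, n = k + 1 := ⟨n - 1, by omega⟩
    simp [deltaWord_succ, List.cons_lt_cons_iff]

theorem isLyndon_delta : IsLyndon ([0, 1] : List (Fin 2)) := by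
  refine ⟨by simp, fun v w hv hw h => ?_⟩
  have hs : w <:+ deltaWord 0 ++ [1] := by
    obtain ⟨a, v, rfl⟩ := List.exists_cons_of_ne_nil hv
    exact ⟨v, (List.cons.inj h).2.symm⟩
  rcases suffix_deltaWord_append hs hw with ⟨j, hj, rfl⟩ | ⟨j, hj, rfl⟩
  · obtain rfl : j = 0 := by omega
    simp [deltaWord_zero, List.cons_lt_cons_iff]
  · omega

theorem not_deltaWord_succ_lt (n : ℕ) : ¬ deltaWord (n + 1) < deltaWord n := by
  induction n with
  | zero => simp [deltaWord_zero]
  | succ n ih =>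
    rw [deltaWord_succ (n + 1), deltaWord_succ n]
    rw [deltaWord_succ n] at ih
    simpa [List.cons_lt_cons_iff] using ih

/-- The remaining suffix has more than two letters. If it starts with x₁, dropping its first x₁x₂
leaves a proper prefix, which is smaller; if it starts with x₂, dropping that letter gives something
smaller. -/
theorem not_isLyndon_drop_deltaWord (n k : ℕ) (hk : k < 2 * n + 2) :
    ¬ IsLyndon ((deltaWord (n + 2)).drop k) := by
  have h0 : ∀ n, ¬ IsLyndon (deltaWord (n + 2)) := fun n => by
    have := not_isLyndon_of_append (v := [0, 1]) (w := deltaWord (n + 1)) (by simp)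
      (by simp [deltaWord_succ])
      (by simpa [deltaWord_succ] using not_deltaWord_succ_lt (n + 1))
    simpa [deltaWord_succ] using this
  have h1 : ∀ n, ¬ IsLyndon (1 :: deltaWord (n + 1)) := fun n =>
    not_isLyndon_of_append (v := [1]) (w := deltaWord (n + 1)) (by simp)
      (by simp [deltaWord_succ]) (by simp [deltaWord_succ, List.cons_lt_cons_iff])
  induction n generalizing k with
  | zero =>
    obtain rfl | rfl : k = 0 ∨ k = 1 := by omega
    · exact h0 0
    · exact h1 0
  | succ n ih =>
    match k with
    | 0 => exact h0 (n + 1)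
    | 1 => exact h1 (n + 1)
    | k + 2 =>
      rw [deltaWord_succ (n + 2), List.drop_succ_cons, List.drop_succ_cons]
      exact ih k (by omega)

variable (Q : Matrix (Fin 2) (Fin 2) ℂ)

theorem superLetter_delta :
    superLetter Q [0, 1] = bracket Q (FreeAlgebra.ι ℂ 0) (FreeAlgebra.ι ℂ 1) := by
  have h : IsLyndonCut ([0, 1] : List (Fin 2)) 1 :=
    ⟨by simp, by simp, isLyndon_zero_cons_deltaWord 0, isLyndon_deltaWord_append 0⟩
  rw [superLetter_of_cut Q h fun j hj hc => by have := hc.1; omega]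
  simp [superLetter_singleton]

theorem superLetter_zero_delta :
    superLetter Q (0 :: deltaWord 1) = bracket Q (FreeAlgebra.ι ℂ 0) (superLetter Q [0, 1]) := by
  have h : IsLyndonCut (0 :: deltaWord 1) 1 :=
    ⟨by simp, by simp [length_deltaWord], isLyndon_zero_cons_deltaWord 0,
      isLyndon_delta⟩
  rw [superLetter_of_cut Q h fun j hj hc => by have := hc.1; omega]
  simp [superLetter_singleton, deltaWord_succ, deltaWord_zero]

/-- The only Lyndon suffix that an admissible cut can leave is the final x₁x₂, so the cut comes as
late as 2n + 3. -/
theorem superLetter_zero_deltaWord (n : ℕ) :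
    superLetter Q (0 :: deltaWord (n + 2)) =
      bracket Q (superLetter Q (0 :: deltaWord (n + 1))) (superLetter Q [0, 1]) := by
  have hd : deltaWord (n + 2) = deltaWord (n + 1) ++ [0, 1] := deltaWord_add (n + 1) 1
  have hl : (deltaWord (n + 1)).length = 2 * n + 2 := by rw [length_deltaWord]; ring
  have ht : (0 :: deltaWord (n + 2)).take (2 * n + 3) = 0 :: deltaWord (n + 1) := by
    rw [List.take_succ_cons, hd, ← hl, List.take_left]
  have hdr : (0 :: deltaWord (n + 2)).drop (2 * n + 3) = [0, 1] := by
    rw [List.drop_succ_cons, hd, ← hl, List.drop_left]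
  have h : IsLyndonCut (0 :: deltaWord (n + 2)) (2 * n + 3) := by
    refine ⟨by omega, by simp [length_deltaWord]; omega, ?_, ?_⟩
    · rw [ht]; exact isLyndon_zero_cons_deltaWord _
    · rw [hdr]; exact isLyndon_delta
  rw [superLetter_of_cut Q h, ht, hdr]
  rintro j hj ⟨hj0, -, -, hl⟩
  obtain ⟨j, rfl⟩ : ∃ k, j = k + 1 := ⟨j - 1, by omega⟩
  rw [List.drop_succ_cons] at hl
  exact not_isLyndon_drop_deltaWord n j (by omega) hl

theorem superLetter_deltaWord_append (n : ℕ) :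
    superLetter Q (deltaWord (n + 1) ++ [1]) =
      bracket Q (superLetter Q [0, 1]) (superLetter Q (deltaWord n ++ [1])) := by
  have h : IsLyndonCut (deltaWord (n + 1) ++ [1]) 2 := by
    rw [deltaWord_succ]
    exact ⟨by simp, by simp, isLyndon_delta, isLyndon_deltaWord_append n⟩
  rw [superLetter_of_cut Q h]
  · rw [deltaWord_succ]; rfl
  · rintro j hj ⟨hj0, -, -, hl⟩
    obtain rfl : j = 1 := by omega
    rw [deltaWord_succ] at hl
    refine not_isLyndon_of_append (v := [1]) (w := deltaWord n ++ [1]) (by simp) (by simp) ?_ hl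
    cases n <;> simp [deltaWord_succ, deltaWord_zero, List.cons_lt_cons_iff]

end Words

end

end DiagonalNichols

namespace DiagonalNichols

/-! ### Abstract root vectors and identities for iterated brackets -/

section RootVectors

variable {A : Type*} [Ring A] [Algebra ℂ A]

/-- Sequences in an algebra satisfying the recursions that define the root vectors and the quantum
Serre relations. -/
structure RootVectors (q : ℂ) (X Y L L' : ℕ → A) : Prop where
  q_ne_zero : q ≠ 0
  q_pow_ne_one : ∀ k : ℕ, 0 < k → q ^ k ≠ 1
  X_succ : ∀ n, X (n + 2) = X (n + 1) * L 1 - (-1 : ℂ) ^ n • (L 1 * X (n + 1))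
  Y_succ : ∀ n, Y (n + 2) = L 1 * Y (n + 1) + (-1 : ℂ) ^ n • (Y (n + 1) * L 1)
  L_zero : L 0 = (1 / theta q) • 1
  L'_zero : L' 0 = (1 / theta q) • 1
  L'_one : L' 1 = L 1
  L_succ : ∀ n, L (n + 1) = X 1 * Y (n + 1) - q⁻¹ • (Y (n + 1) * X 1)
  L'_succ : ∀ n, L' (n + 2) = X 2 * Y (n + 1) + ((-1) ^ n * q⁻¹) • (Y (n + 1) * X 2)
  serre_X : X 1 * X 2 = q • (X 2 * X 1)
  serre_Y : Y 2 * Y 1 = q • (Y 1 * Y 2)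

/-- The braided bracket of `X a` and `Y b`. -/
noncomputable def pairing (q : ℂ) (X Y : ℕ → A) (a b : ℕ) : A :=
  X a * Y b - ((-1) ^ ((a + 1) * b) * q⁻¹) • (Y b * X a)

/-- A braided Jacobi identity: the q-commutation is multiplied by Y on either side, and the mixed
terms UYV and VYU are absorbed into the brackets. The scalars m and m' carry the signs of the
bicharacter. -/
theorem left_pairing_comm {q m m' : ℂ} (hq : q ≠ 0) {U V Y M N : A} (h : U * V = q • (V * U))
    (hM : M = U * Y - (m * q⁻¹) • (Y * U)) (hN : N = V * Y - (m' * q⁻¹) • (Y * V)) :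
    U * N - m • (N * U) = q • (V * M) - (m' * q⁻¹) • (M * V) := by
  subst hM hN
  linear_combination (norm := skip) h * Y - (m * m' * q⁻¹ ^ 2) • (Y * h)
  simp only [mul_add, add_mul, mul_sub, sub_mul, smul_mul_assoc, mul_smul_comm, mul_assoc]
  match_scalars <;> field_simp <;> ring

theorem right_pairing_comm {q m m' : ℂ} (hq : q ≠ 0) {U V X M N : A} (h : V * U = q • (U * V))
    (hM : M = X * U - (m * q⁻¹) • (U * X)) (hN : N = X * V - (m' * q⁻¹) • (V * X)) :
    N * U - m • (U * N) = q • (M * V) - (m' * q⁻¹) • (V * M) := by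
  subst hM hN
  linear_combination (norm := skip) X * h - (m * m' * q⁻¹ ^ 2) • (h * X)
  simp only [mul_add, add_mul, mul_sub, sub_mul, smul_mul_assoc, mul_smul_comm, mul_assoc]
  match_scalars <;> field_simp <;> ring

/-- The version for root vectors whose indices differ by two, with W the one in between. U and V
then have the same sign m against Y, and W² adds a term in the bracket of W with Y. -/
theorem left_pairing_comm_sq {q m m' s t : ℂ} (hq : q ≠ 0) (hm : m * m = 1) (hm' : m' * m' = 1)
    {U V W Y M N K : A} (h : U * V = (s * q) • (V * U) + t • (W * W))
    (hM : M = U * Y - (m * q⁻¹) • (Y * U)) (hN : N = V * Y - (m * q⁻¹) • (Y * V))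
    (hK : K = W * Y - (m' * q⁻¹) • (Y * W)) :
    U * N - (s * m) • (N * U) =
      (s * q) • (V * M) - (m * q⁻¹) • (M * V) + t • (W * K + (m' * q⁻¹) • (K * W)) := by
  subst hM hN hK
  have e1 : m * q⁻¹ * (m * q⁻¹) = q⁻¹ ^ 2 := by linear_combination q⁻¹ ^ 2 * hm
  have e2 : m' * q⁻¹ * (m' * q⁻¹) = q⁻¹ ^ 2 := by linear_combination q⁻¹ ^ 2 * hm'
  have e3 : s * m * (m * q⁻¹) = s * q⁻¹ := by linear_combination s * q⁻¹ * hm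
  linear_combination (norm := skip) h * Y - (q⁻¹ ^ 2) • (Y * h)
  simp only [mul_add, add_mul, mul_sub, sub_mul, smul_mul_assoc, mul_smul_comm, mul_assoc,
    smul_add, smul_sub, smul_smul] at e1 e2 e3 ⊢
  simp only [e1, e2, e3]
  match_scalars <;> field_simp <;> ring

theorem right_pairing_comm_sq {q m m' s t : ℂ} (hq : q ≠ 0) (hm : m * m = 1) (hm' : m' * m' = 1)
    {U V W X M N K : A} (h : V * U = (s * q) • (U * V) + t • (W * W))
    (hM : M = X * U - (m * q⁻¹) • (U * X)) (hN : N = X * V - (m * q⁻¹) • (V * X))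
    (hK : K = X * W - (m' * q⁻¹) • (W * X)) :
    N * U - (s * m) • (U * N) =
      (s * q) • (M * V) - (m * q⁻¹) • (V * M) + t • (K * W + (m' * q⁻¹) • (W * K)) := by
  subst hM hN hK
  have e1 : m * q⁻¹ * (m * q⁻¹) = q⁻¹ ^ 2 := by linear_combination q⁻¹ ^ 2 * hm
  have e2 : m' * q⁻¹ * (m' * q⁻¹) = q⁻¹ ^ 2 := by linear_combination q⁻¹ ^ 2 * hm'
  have e3 : s * m * (m * q⁻¹) = s * q⁻¹ := by linear_combination s * q⁻¹ * hm
  linear_combination (norm := skip) X * h - (q⁻¹ ^ 2) • (h * X)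
  simp only [mul_add, add_mul, mul_sub, sub_mul, smul_mul_assoc, mul_smul_comm, mul_assoc,
    smul_add, smul_sub, smul_smul] at e1 e2 e3 ⊢
  simp only [e1, e2, e3]
  match_scalars <;> field_simp <;> ring

end RootVectors

end DiagonalNichols

namespace DiagonalNichols

/-! ### Relations in low degree; consecutive root vectors q-commute -/

section LowDegree

set_option linter.unusedSimpArgs false

variable {A : Type*} [Ring A] [Algebra ℂ A] {q : ℂ} {X Y L L' : ℕ → A}

namespace RootVectors

theorem theta_ne_zero (h : RootVectors q X Y L L') : q - q⁻¹ ≠ 0 := by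
  intro h0
  have hq := h.q_ne_zero
  apply h.q_pow_ne_one 2 (by norm_num)
  field_simp at h0
  linear_combination h0

theorem theta_smul_L_zero (h : RootVectors q X Y L L') : (q - q⁻¹) • L 0 = 1 := by
  rw [h.L_zero, theta, smul_smul, mul_one_div_cancel h.theta_ne_zero, one_smul]

theorem theta_smul_L'_zero (h : RootVectors q X Y L L') : (q - q⁻¹) • L' 0 = 1 := by
  rw [h.L'_zero, theta, smul_smul, mul_one_div_cancel h.theta_ne_zero, one_smul]

theorem X_two (h : RootVectors q X Y L L') : X 2 = X 1 * L 1 - L 1 * X 1 := by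
  simpa using h.X_succ 0

theorem X_three (h : RootVectors q X Y L L') : X 3 = X 2 * L 1 + L 1 * X 2 := by
  simpa using h.X_succ 1

theorem X_four (h : RootVectors q X Y L L') : X 4 = X 3 * L 1 - L 1 * X 3 := by
  simpa using h.X_succ 2

theorem Y_two (h : RootVectors q X Y L L') : Y 2 = L 1 * Y 1 + Y 1 * L 1 := by
  simpa using h.Y_succ 0

theorem Y_three (h : RootVectors q X Y L L') : Y 3 = L 1 * Y 2 - Y 2 * L 1 := by
  simpa [sub_eq_add_neg] using h.Y_succ 1

theorem Y_four (h : RootVectors q X Y L L') : Y 4 = L 1 * Y 3 + Y 3 * L 1 := by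
  simpa using h.Y_succ 2

/-- The square of `L 1` shifts the index of `X` by two. -/
theorem X_add_two (h : RootVectors q X Y L L') (n : ℕ) :
    X (n + 3) = X (n + 1) * (L 1 * L 1) - L 1 * L 1 * X (n + 1) := by
  rw [h.X_succ (n + 1), h.X_succ n, pow_succ]
  rcases neg_one_pow_eq_or ℂ n with hs | hs <;> simp only [hs] <;> simp <;> noncomm_ring

/-- The square of `L 1` shifts the index of `Y` by two. -/
theorem Y_add_two (h : RootVectors q X Y L L') (n : ℕ) :
    Y (n + 3) = L 1 * L 1 * Y (n + 1) - Y (n + 1) * (L 1 * L 1) := by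
  rw [h.Y_succ (n + 1), h.Y_succ n, pow_succ]
  rcases neg_one_pow_eq_or ℂ n with hs | hs <;> simp only [hs] <;> simp <;> noncomm_ring

theorem pairing_one (h : RootVectors q X Y L L') (n : ℕ) :
    pairing q X Y 1 (n + 1) = L (n + 1) := by
  rw [h.L_succ, pairing, pow_mul]
  norm_num

theorem pairing_two (h : RootVectors q X Y L L') (n : ℕ) :
    pairing q X Y 2 (n + 1) = L' (n + 2) := by
  rw [h.L'_succ, pairing, pow_mul]
  norm_num [pow_succ]

/-- The commutator with L₁² is a derivation that raises the index of X by two and, up to sign, that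
of Y; the bicharacter does not notice a shift by two. -/
theorem pairing_shift (h : RootVectors q X Y L L') (a b : ℕ) :
    pairing q X Y (a + 3) (b + 1) - pairing q X Y (a + 1) (b + 3) =
      pairing q X Y (a + 1) (b + 1) * (L 1 * L 1) - L 1 * L 1 * pairing q X Y (a + 1) (b + 1) := by
  have e1 : ((-1 : ℂ) ^ ((a + 3 + 1) * (b + 1))) = (-1) ^ ((a + 1 + 1) * (b + 1)) := by
    rw [show (a + 3 + 1) * (b + 1) = (a + 1 + 1) * (b + 1) + 2 * (b + 1) by ring, pow_add]; simp
  have e2 : ((-1 : ℂ) ^ ((a + 1 + 1) * (b + 3))) = (-1) ^ ((a + 1 + 1) * (b + 1)) := by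
    rw [show (a + 1 + 1) * (b + 3) = (a + 1 + 1) * (b + 1) + 2 * (a + 1 + 1) by ring, pow_add]
    simp
  simp only [pairing, e1, e2, h.X_add_two, h.Y_add_two]
  simp only [mul_add, add_mul, mul_sub, sub_mul, smul_mul_assoc, mul_smul_comm, mul_assoc]
  module

/-- Expand Y_{n+2} inside L_{n+2} and move X₁ past L₁; the correction X₂ produces the L' term. -/
theorem L_succ_eq (h : RootVectors q X Y L L') (n : ℕ) :
    L (n + 2) = L' (n + 2) + L 1 * L (n + 1) + (-1 : ℂ) ^ n • (L (n + 1) * L 1) := by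
  rw [h.L_succ (n + 1), h.L'_succ n, h.Y_succ n, h.X_two, h.L_succ n]
  simp only [mul_add, add_mul, mul_sub, sub_mul, smul_mul_assoc, mul_smul_comm, mul_assoc]
  module

theorem L_two (h : RootVectors q X Y L L') : L 2 = L' 2 + (2 : ℂ) • (L 1 * L 1) := by
  rw [h.L_succ_eq 0]
  simp only [zero_add, pow_zero, one_smul]
  module

theorem L_three (h : RootVectors q X Y L L') : L 3 = L' 3 + L 1 * L 2 - L 2 * L 1 := by
  rw [h.L_succ_eq 1]
  simp only [Nat.reduceAdd, pow_one]
  module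

theorem L_one (h : RootVectors q X Y L L') : L 1 = X 1 * Y 1 - q⁻¹ • (Y 1 * X 1) := h.L_succ 0

/-- The Serre relation bracketed once with L₁; `X_one_mul_X_four` uses L₁² instead, and the Y
relations are mirror images. -/
theorem X_one_mul_X_three (h : RootVectors q X Y L L') :
    X 1 * X 3 = q • (X 3 * X 1) + (1 + q) • (X 2 * X 2) := by
  linear_combination (norm := skip) h.serre_X * L 1 + L 1 * h.serre_X + X 1 * h.X_three
    - q • (h.X_three * X 1) - h.X_two * X 2 - q • (X 2 * h.X_two)
  simp only [mul_add, add_mul, mul_sub, sub_mul, smul_mul_assoc, mul_smul_comm, mul_assoc]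
  module

theorem Y_three_mul_Y_one (h : RootVectors q X Y L L') :
    Y 3 * Y 1 = -q • (Y 1 * Y 3) + (q - 1) • (Y 2 * Y 2) := by
  linear_combination (norm := skip) L 1 * h.serre_Y + h.serre_Y * L 1 + h.Y_three * Y 1
    + q • (Y 1 * h.Y_three) + Y 2 * h.Y_two - q • (h.Y_two * Y 2)
  simp only [mul_add, add_mul, mul_sub, sub_mul, smul_mul_assoc, mul_smul_comm, mul_assoc]
  module

theorem X_one_mul_X_four (h : RootVectors q X Y L L') :
    X 1 * X 4 - q • (X 4 * X 1) = q • (X 2 * X 3) - X 3 * X 2 := by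
  linear_combination (norm := skip) h.serre_X * (L 1 * L 1) - (L 1 * L 1) * h.serre_X
    + X 1 * h.X_add_two 1 - q • (h.X_add_two 1 * X 1) + h.X_add_two 0 * X 2
    - q • (X 2 * h.X_add_two 0)
  simp only [mul_add, add_mul, mul_sub, sub_mul, smul_mul_assoc, mul_smul_comm, mul_assoc]
  module

theorem Y_four_mul_Y_one (h : RootVectors q X Y L L') :
    Y 4 * Y 1 - q • (Y 1 * Y 4) = q • (Y 3 * Y 2) - Y 2 * Y 3 := by
  linear_combination (norm := skip) (L 1 * L 1) * h.serre_Y - h.serre_Y * (L 1 * L 1)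
    + h.Y_add_two 1 * Y 1 - q • (Y 1 * h.Y_add_two 1) + Y 2 * h.Y_add_two 0
    - q • (h.Y_add_two 0 * Y 2)
  simp only [mul_add, add_mul, mul_sub, sub_mul, smul_mul_assoc, mul_smul_comm, mul_assoc]
  module

theorem X_one_comm_L'_two (h : RootVectors q X Y L L') :
    X 1 * L' 2 - L' 2 * X 1 = q • X 3 - (q - q⁻¹) • (L 1 * X 2) := by
  have h1 := left_pairing_comm (m := 1) (m' := -1) (Y := Y 1) h.q_ne_zero h.serre_X
    (by simpa using h.L_one) (by simpa using h.L'_succ 0)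
  rw [h.X_three]
  linear_combination (norm := module) h1

theorem X_one_comm_L_two (h : RootVectors q X Y L L') :
    X 1 * L 2 - L 2 * X 1 = (q + 2) • X 3 - (q - q⁻¹) • (L 1 * X 2) := by
  linear_combination (norm := skip) h.X_one_comm_L'_two + X 1 * h.L_two - h.L_two * X 1
    - (2 : ℂ) • h.X_add_two 0
  simp only [mul_add, add_mul, mul_sub, sub_mul, smul_mul_assoc, mul_smul_comm, mul_assoc]
  module

theorem L_two_comm_Y_one (h : RootVectors q X Y L L') :
    L 2 * Y 1 - Y 1 * L 2 = q • Y 3 + (q - q⁻¹) • (Y 2 * L 1) := by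
  have h1 := right_pairing_comm (m := 1) (m' := 1) (X := X 1) h.q_ne_zero h.serre_Y
    (by simpa using h.L_one) (by simpa using h.L_succ 1)
  rw [h.Y_three]
  linear_combination (norm := module) h1

theorem L'_two_comm_Y_one (h : RootVectors q X Y L L') :
    L' 2 * Y 1 - Y 1 * L' 2 = (q - 2) • Y 3 + (q - q⁻¹) • (Y 2 * L 1) := by
  linear_combination (norm := skip) h.L_two_comm_Y_one - h.L_two * Y 1 + Y 1 * h.L_two
    + (2 : ℂ) • h.Y_add_two 0
  simp only [mul_add, add_mul, mul_sub, sub_mul, smul_mul_assoc, mul_smul_comm, mul_assoc]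
  module

theorem L_three_eq_pairing (h : RootVectors q X Y L L') :
    L 3 = X 3 * Y 1 - q⁻¹ • (Y 1 * X 3) := by
  have h1 := h.pairing_shift 0 0
  rw [h.pairing_one 0, h.pairing_one 2] at h1
  simp only [pairing, Nat.reduceAdd, Nat.reduceMul] at h1
  linear_combination (norm := skip) -h1
  simp only [mul_assoc]
  match_scalars <;> norm_num

/-- The commutator of L₁ and L₂ is computed twice: from the recursion for L₃, and by writing L₁ as
the bracket of X₁ and Y₁ and moving L₂ past each factor. -/
theorem L_three_add_L'_three (h : RootVectors q X Y L L') :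
    L 3 + L' 3 = (q - q⁻¹) • (L 2 * L 1 + L 1 * L' 2) := by
  have h2 := h.L_succ 1
  have h2' : L' 2 = X 2 * Y 1 + q⁻¹ • (Y 1 * X 2) := by simpa using h.L'_succ 0
  have key : L 1 * L 2 - L 2 * L 1 =
      (2 : ℂ) • L 3 - (q - q⁻¹) • (L 2 * L 1 + L 1 * L' 2) := by
    linear_combination (norm := skip) h.L_one * L 2 - L 2 * h.L_one - X 1 * h.L_two_comm_Y_one
      + q⁻¹ • (h.L_two_comm_Y_one * X 1) + h.X_one_comm_L_two * Y 1
      - q⁻¹ • (Y 1 * h.X_one_comm_L_two) + q • h.L_succ 2 - (q + 2) • h.L_three_eq_pairing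
      + (q - q⁻¹) • (h2 * L 1) + (q - q⁻¹) • (L 1 * h2')
      + ((q - q⁻¹) * q⁻¹) • (Y 2 * h.X_two) - ((q - q⁻¹) * q⁻¹) • (h.Y_two * X 2)
    simp only [mul_add, add_mul, mul_sub, sub_mul, smul_mul_assoc, mul_smul_comm, mul_assoc,
      Nat.reduceAdd]
    module
  linear_combination (norm := module) -key - h.L_three

/-- The commutator of X₁ with `L_three_add_L'_three` contains the unknown bracket with coefficient 1
+ q + q⁻¹, which is nonzero because q³ ≠ 1. -/
theorem X_two_comm_L_two (h : RootVectors q X Y L L') :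
    X 2 * L 2 - L 2 * X 2 = q • (X 3 * L 1) - q⁻¹ • (L 1 * X 3) := by
  have hq := h.q_ne_zero
  have hne : 1 + q + q⁻¹ ≠ 0 := by
    intro h0
    apply h.q_pow_ne_one 3 (by norm_num)
    field_simp at h0
    linear_combination (q - 1) * h0
  have hA3 := left_pairing_comm (m := 1) (m' := 1) (Y := Y 2) hq h.serre_X
    (by simpa using h.L_succ 1) (by simpa [sub_eq_add_neg] using h.L'_succ 1)
  have e := h.L_three_add_L'_three
  have key : (1 + q + q⁻¹) • (X 2 * L 2 - L 2 * X 2) =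
      (1 + q + q⁻¹) • (q • (X 3 * L 1) - q⁻¹ • (L 1 * X 3)) := by
    have h3 := h.X_three
    have hX2 := h.X_two
    have hA := h.X_one_comm_L_two
    have hA' := h.X_one_comm_L'_two
    linear_combination (norm := skip) X 1 * e - e * X 1
      - (2 : ℂ) • hA3 - (X 1 * h.L_three - h.L_three * X 1) + hX2 * L 2 - L 2 * hX2
      - L 1 * hA + hA * L 1
      + (q - q⁻¹) • (hA * L 1 - L 2 * hX2 - hX2 * L' 2 + L 1 * hA' - X 2 * h.L_two)
      + ((q - q⁻¹) + (q - q⁻¹) ^ 2) • (L 1 * h3) + (2 * (q - q⁻¹)) • (h3 * L 1 - L 1 * h3)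
    simp only [mul_add, add_mul, mul_sub, sub_mul, smul_mul_assoc, mul_smul_comm, mul_assoc]
    match_scalars <;> field_simp <;> ring
  exact smul_right_injective A hne key

/-- Mirror of `X_two_comm_L_two`. Odd degree against Y₁ carries a sign, so the degree-three relation
is anticommuted with Y₁; the coefficient becomes q + q⁻¹ - 1, a factor of q⁶ - 1 up to a unit. -/
theorem L'_two_comm_Y_two (h : RootVectors q X Y L L') :
    L' 2 * Y 2 - Y 2 * L' 2 = q • (L 1 * Y 3) + q⁻¹ • (Y 3 * L 1) := by
  have hq := h.q_ne_zero
  have hne : q + q⁻¹ - 1 ≠ 0 := by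
    intro h0
    apply h.q_pow_ne_one 6 (by norm_num)
    field_simp at h0
    linear_combination (q + 1) * (q ^ 3 - 1) * h0
  have hC3 := right_pairing_comm (m := -1) (m' := 1) (X := X 2) hq h.serre_Y
    (by simpa using h.L'_succ 0) (by simpa [sub_eq_add_neg] using h.L'_succ 1)
  have e := h.L_three_add_L'_three
  have key : (q + q⁻¹ - 1) • (L' 2 * Y 2 - Y 2 * L' 2) =
      (q + q⁻¹ - 1) • (q • (L 1 * Y 3) + q⁻¹ • (Y 3 * L 1)) := by
    have h3 := h.Y_three
    have hY2 := h.Y_two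
    have hL2 := h.L_two
    have ha := h.L_two_comm_Y_one
    have ha' := h.L'_two_comm_Y_one
    have hc : L 1 * L 2 - L 2 * L 1 = L 1 * L' 2 - L' 2 * L 1 := by
      rw [hL2]; noncomm_ring
    linear_combination (norm := skip) e * Y 1 + Y 1 * e - (2 : ℂ) • hC3
      - (h.L_three * Y 1 + Y 1 * h.L_three) - (hc * Y 1 + Y 1 * hc)
      - L 1 * ha' - L' 2 * hY2 - ha' * L 1 + hY2 * L' 2
      + (q - q⁻¹) • (L 1 * ha' - L 2 * hY2 - ha * L 1 - hY2 * L' 2 + hL2 * Y 2)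
      + ((q - q⁻¹) - (q - q⁻¹) ^ 2) • (h3 * L 1) - (2 * (q - q⁻¹)) • (L 1 * h3 + h3 * L 1)
    simp only [mul_add, add_mul, mul_sub, sub_mul, smul_mul_assoc, mul_smul_comm, mul_assoc]
    match_scalars <;> field_simp <;> ring
  exact smul_right_injective A hne key

theorem q_add_inv_ne_zero (h : RootVectors q X Y L L') : q + q⁻¹ ≠ 0 := by
  intro h0
  have hq := h.q_ne_zero
  apply h.q_pow_ne_one 4 (by norm_num)
  field_simp at h0
  linear_combination (q ^ 2 - 1) * h0

/-- Commuting the Serre relation with L₂ gives the claim multiplied by q + q⁻¹, nonzero because q⁴ ≠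
1. -/
theorem X_two_mul_X_three (h : RootVectors q X Y L L') : X 2 * X 3 = q • (X 3 * X 2) := by
  have hq := h.q_ne_zero
  have key : (q + q⁻¹) • (X 2 * X 3) = (q + q⁻¹) • (q • (X 3 * X 2)) := by
    have hS := h.serre_X
    have hB := h.X_two_comm_L_two
    have hA := h.X_one_comm_L_two
    have h4 := h.X_four
    linear_combination (norm := skip) -(hS * L 2 - L 2 * hS - (X 1 * hB + hA * X 2)
      + q • (X 2 * hA + hB * X 1) + q • (X 1 * h4) - (q ^ 2) • (h4 * X 1)
      + (q - q⁻¹) • (h.X_two * X 3 - L 1 * h.X_one_mul_X_three + q • (h.X_three * X 2))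
      - q • h.X_one_mul_X_four)
    simp only [mul_add, add_mul, mul_sub, sub_mul, smul_mul_assoc, mul_smul_comm, mul_assoc]
    match_scalars <;> field_simp <;> ring
  exact smul_right_injective A h.q_add_inv_ne_zero key

theorem Y_three_mul_Y_two (h : RootVectors q X Y L L') : Y 3 * Y 2 = q • (Y 2 * Y 3) := by
  have hq := h.q_ne_zero
  have key : (q + q⁻¹) • (Y 3 * Y 2) = (q + q⁻¹) • (q • (Y 2 * Y 3)) := by
    have hS := h.serre_Y
    have hB := h.L'_two_comm_Y_two
    have hA := h.L'_two_comm_Y_one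
    have h4 := h.Y_four
    linear_combination (norm := skip) L' 2 * hS - hS * L' 2 - (hB * Y 1 + Y 2 * hA)
      + q • (hA * Y 2 + Y 1 * hB) + q • (h4 * Y 1) - (q ^ 2) • (Y 1 * h4)
      - (q - q⁻¹) • (Y 3 * h.Y_two + q • (Y 2 * h.Y_three) + h.Y_three_mul_Y_one * L 1)
      - q • h.Y_four_mul_Y_one
    simp only [mul_add, add_mul, mul_sub, sub_mul, smul_mul_assoc, mul_smul_comm, mul_assoc]
    match_scalars <;> field_simp <;> ring
  exact smul_right_injective A h.q_add_inv_ne_zero key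

end RootVectors

end LowDegree

end DiagonalNichols

namespace DiagonalNichols

/-! ### The square of L₁ commutes with all L_n -/

section SquareCommutes

set_option linter.unusedSimpArgs false

variable {A : Type*} [Ring A] [Algebra ℂ A] {q : ℂ} {X Y L L' : ℕ → A}

/-- Skew derivations `d₁`, `d₂` with twists `t₁`, `t₂` which detect commutators. -/
structure SkewDerivations (q : ℂ) (x y : A) (d₁ d₂ t₁ t₂ : A →ₗ[ℂ] A) : Prop where
  t₁_mul : ∀ a b, t₁ (a * b) = t₁ a * t₁ b
  t₂_mul : ∀ a b, t₂ (a * b) = t₂ a * t₂ b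
  d₁_mul : ∀ a b, d₁ (a * b) = a * d₁ b + d₁ a * t₁ b
  d₂_mul : ∀ a b, d₂ (a * b) = a * d₂ b + d₂ a * t₂ b
  t₁_x : t₁ x = q • x
  t₁_y : t₁ y = q⁻¹ • y
  t₂_x : t₂ x = q⁻¹ • x
  t₂_y : t₂ y = -q • y
  d₁_x : d₁ x = 1
  d₁_y : d₁ y = 0
  d₂_x : d₂ x = 0
  d₂_y : d₂ y = 1
  commute_of : ∀ a b, d₁ (a * b - b * a) = 0 → d₂ (a * b - b * a) = 0 → a * b = b * a

namespace RootVectors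

theorem mul_L_zero_comm (h : RootVectors q X Y L L') (a : A) : a * L 0 = L 0 * a := by
  simp [h.L_zero]

theorem mul_L'_zero_comm (h : RootVectors q X Y L L') (a : A) : a * L' 0 = L' 0 * a := by
  simp [h.L'_zero]

theorem pairing_three (h : RootVectors q X Y L L') (k : ℕ)
    (hC : L 1 * L 1 * L (k + 1) = L (k + 1) * (L 1 * L 1)) :
    pairing q X Y 3 (k + 1) = L (k + 3) := by
  have h1 := h.pairing_shift 0 k
  rw [Nat.zero_add, Nat.zero_add, h.pairing_one (k + 2), h.pairing_one k, hC, sub_self,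
    sub_eq_zero] at h1
  exact h1

theorem X_two_comm_L_of_commute (h : RootVectors q X Y L L') (k : ℕ)
    (hC : L 1 * L 1 * L (k + 1) = L (k + 1) * (L 1 * L 1)) :
    X 2 * L (k + 3) + (-1 : ℂ) ^ k • (L (k + 3) * X 2) =
      q • (X 3 * L' (k + 2)) - q⁻¹ • (L' (k + 2) * X 3) := by
  have hN : L (k + 3) = X 3 * Y (k + 1) - (1 * q⁻¹) • (Y (k + 1) * X 3) := by
    rw [← h.pairing_three k hC, pairing, pow_mul]; norm_num
  have hM : L' (k + 2) = X 2 * Y (k + 1) - (-(-1) ^ k * q⁻¹) • (Y (k + 1) * X 2) := by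
    rw [h.L'_succ]; module
  linear_combination (norm := module)
    left_pairing_comm h.q_ne_zero h.X_two_mul_X_three hM hN

theorem commute_L' (h : RootVectors q X Y L L') (n : ℕ)
    (hC : ∀ m ≤ n, L 1 * L 1 * L m = L m * (L 1 * L 1)) :
    L 1 * L 1 * L' n = L' n * (L 1 * L 1) := by
  match n with
  | 0 => exact h.mul_L'_zero_comm _
  | 1 => rw [h.L'_one, mul_assoc]
  | n + 2 =>
    have e := h.L_succ_eq n
    have h1 := hC (n + 1) (by omega)
    linear_combination (norm := skip) hC (n + 2) le_rfl - L 1 * L 1 * e + e * (L 1 * L 1)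
      - L 1 * h1 - (-1 : ℂ) ^ n • (h1 * L 1)
    simp only [mul_add, add_mul, mul_sub, sub_mul, smul_mul_assoc, mul_smul_comm, mul_assoc]
    module

/-- Inverts the recursion `L_succ_eq`: applying it twice, the terms L₁L_{k}L₁ cancel by sign and the
two terms with L₁² cancel by commutation in lower index. -/
theorem L'_succ_eq (h : RootVectors q X Y L L') (n : ℕ)
    (hC : ∀ m < n, L 1 * L 1 * L m = L m * (L 1 * L 1)) :
    L' (n + 1) = L (n + 1) - L 1 * L' n + (-1 : ℂ) ^ n • (L' n * L 1) := by
  match n with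
  | 0 =>
    rw [h.mul_L'_zero_comm]
    simp [h.L'_one]
  | 1 =>
    have := h.L_two
    linear_combination (norm := skip) -this
    simp only [Nat.reduceAdd, h.L'_one]
    module
  | n + 2 =>
    have e := h.L_succ_eq n
    have e' := h.L_succ_eq (n + 1)
    have h1 := hC (n + 1) (by omega)
    rcases neg_one_pow_eq_or ℂ n with hs | hs
    all_goals
      simp only [pow_succ, hs] at e e' ⊢
      linear_combination (norm := skip) -e' - L 1 * e - h1
    · linear_combination (norm := skip) e * L 1
      simp only [mul_add, add_mul, mul_sub, sub_mul, smul_mul_assoc, mul_smul_comm, mul_assoc]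
      module
    · linear_combination (norm := skip) - e * L 1
      simp only [mul_add, add_mul, mul_sub, sub_mul, smul_mul_assoc, mul_smul_comm, mul_assoc]
      module

variable {d₁ d₂ t₁ t₂ : A →ₗ[ℂ] A}

theorem t₁_L_one (h : RootVectors q X Y L L') (D : SkewDerivations q (X 1) (Y 1) d₁ d₂ t₁ t₂) :
    t₁ (L 1) = L 1 := by
  have hq := h.q_ne_zero
  simp only [h.L_one, map_sub, map_smul, D.t₁_mul, D.t₁_x, D.t₁_y, smul_mul_assoc, mul_smul_comm]
  match_scalars <;> field_simp

theorem t₂_L_one (h : RootVectors q X Y L L') (D : SkewDerivations q (X 1) (Y 1) d₁ d₂ t₁ t₂) :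
    t₂ (L 1) = -L 1 := by
  have hq := h.q_ne_zero
  simp only [h.L_one, map_sub, map_smul, D.t₂_mul, D.t₂_x, D.t₂_y, smul_mul_assoc, mul_smul_comm]
  match_scalars <;> field_simp

theorem t₁_Y (h : RootVectors q X Y L L') (D : SkewDerivations q (X 1) (Y 1) d₁ d₂ t₁ t₂)
    (n : ℕ) : t₁ (Y (n + 1)) = q⁻¹ • Y (n + 1) := by
  induction n with
  | zero => exact D.t₁_y
  | succ n ih =>
    rw [h.Y_succ, map_add, map_smul, D.t₁_mul, D.t₁_mul, ih, h.t₁_L_one D, smul_mul_assoc,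
      mul_smul_comm]
    module

theorem t₂_Y (h : RootVectors q X Y L L') (D : SkewDerivations q (X 1) (Y 1) d₁ d₂ t₁ t₂)
    (n : ℕ) : t₂ (Y (n + 1)) = (-(-1) ^ n * q) • Y (n + 1) := by
  induction n with
  | zero => simpa using D.t₂_y
  | succ n ih =>
    rw [h.Y_succ, map_add, map_smul, D.t₂_mul, D.t₂_mul, ih, h.t₂_L_one D]
    simp only [smul_mul_assoc, mul_smul_comm, mul_neg, neg_mul, pow_succ]
    module

theorem t₂_L (h : RootVectors q X Y L L') (D : SkewDerivations q (X 1) (Y 1) d₁ d₂ t₁ t₂)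
    (n : ℕ) : t₂ (L (n + 1)) = (-(-1) ^ n : ℂ) • L (n + 1) := by
  have hq := h.q_ne_zero
  rw [h.L_succ, map_sub, map_smul, D.t₂_mul, D.t₂_mul, h.t₂_Y D, D.t₂_x]
  simp only [smul_mul_assoc, mul_smul_comm]
  match_scalars <;> field_simp

theorem d₁_L_one (h : RootVectors q X Y L L') (D : SkewDerivations q (X 1) (Y 1) d₁ d₂ t₁ t₂) :
    d₁ (L 1) = 0 := by
  simp [h.L_one, D.d₁_mul, D.d₁_x, D.d₁_y, D.t₁_y]

theorem d₁_Y (h : RootVectors q X Y L L') (D : SkewDerivations q (X 1) (Y 1) d₁ d₂ t₁ t₂)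
    (n : ℕ) : d₁ (Y (n + 1)) = 0 := by
  induction n with
  | zero => exact D.d₁_y
  | succ n ih => simp [h.Y_succ, D.d₁_mul, ih, h.d₁_L_one D]

/-- The twist multiplies Y_{n+1} by q⁻¹, exactly the coefficient in the bracket, so the two
contributions cancel. -/
theorem d₁_L (h : RootVectors q X Y L L') (D : SkewDerivations q (X 1) (Y 1) d₁ d₂ t₁ t₂)
    (n : ℕ) : d₁ (L (n + 1)) = 0 := by
  simp [h.L_succ n, D.d₁_mul, D.d₁_x, h.d₁_Y D, h.t₁_Y D]

theorem d₂_L_one (h : RootVectors q X Y L L') (D : SkewDerivations q (X 1) (Y 1) d₁ d₂ t₁ t₂) :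
    d₂ (L 1) = (1 - q⁻¹ ^ 2) • X 1 := by
  simp only [h.L_one, map_sub, map_smul, D.d₂_mul, D.d₂_x, D.d₂_y, D.t₂_x, mul_one, zero_mul,
    mul_zero, one_mul]
  module

theorem d₂_L_one_sq (h : RootVectors q X Y L L')
    (D : SkewDerivations q (X 1) (Y 1) d₁ d₂ t₁ t₂) :
    d₂ (L 1 * L 1) = -(1 - q⁻¹ ^ 2) • X 2 := by
  rw [D.d₂_mul, h.d₂_L_one D, h.t₂_L_one D, h.X_two, mul_smul_comm, smul_mul_assoc, mul_neg]
  module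

/-- Differentiating L₁ in the recursion for Y yields a multiple of the bracket of X₁ with Y, that
is, of L; differentiating Y yields L' multiplied by L₁. Together they form the recursion
`L'_succ_eq`. -/
theorem d₂_Y (h : RootVectors q X Y L L') (D : SkewDerivations q (X 1) (Y 1) d₁ d₂ t₁ t₂)
    (n : ℕ) (hC : ∀ m < n, L 1 * L 1 * L m = L m * (L 1 * L 1)) :
    d₂ (Y (n + 1)) = ((-1) ^ n * (q - q⁻¹)) • L' n := by
  have hq := h.q_ne_zero
  induction n with
  | zero => simp [D.d₂_y, h.theta_smul_L'_zero]
  | succ n ih =>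
    have ih := ih fun m hm => hC m (by omega)
    rw [h.Y_succ, map_add, map_smul, D.d₂_mul, D.d₂_mul, ih, h.d₂_L_one D, h.t₂_L_one D, h.t₂_Y D,
      h.L'_succ_eq n fun m hm => hC m (by omega), h.L_succ n]
    simp only [smul_mul_assoc, mul_smul_comm, mul_neg, pow_succ]
    rcases neg_one_pow_eq_or ℂ n with hs | hs <;> rw [hs] <;> match_scalars <;> field_simp

theorem d₂_L (h : RootVectors q X Y L L') (D : SkewDerivations q (X 1) (Y 1) d₁ d₂ t₁ t₂)
    (n : ℕ) (hC : ∀ m < n, L 1 * L 1 * L m = L m * (L 1 * L 1)) :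
    d₂ (L (n + 1)) =
      ((-1) ^ n * (q - q⁻¹)) • (X 1 * L' n - q⁻¹ ^ 2 • (L' n * X 1)) := by
  rw [h.L_succ, map_sub, map_smul, D.d₂_mul, D.d₂_mul, D.d₂_x, D.t₂_x, h.d₂_Y D n hC]
  simp only [smul_mul_assoc, mul_smul_comm, mul_zero, zero_mul]
  module

/-- The square of `L 1` commutes with all `L n`. -/
theorem commute_L (h : RootVectors q X Y L L') (D : SkewDerivations q (X 1) (Y 1) d₁ d₂ t₁ t₂)
    (n : ℕ) : L 1 * L 1 * L n = L n * (L 1 * L 1) := by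
  have hq := h.q_ne_zero
  induction n using Nat.strong_induction_on with
  | _ n ih =>
  obtain rfl | ⟨k, rfl⟩ : n = 0 ∨ ∃ k, n = k + 1 := by
    cases n <;> simp
  · exact h.mul_L_zero_comm _
  -- The case k = 0 is the recursion for X₃ and k = 1 the low-degree relation. For larger k the
  -- bracket of X₃ with Y_{k-1} is L_{k+1}, by the commutation already known for L_{k-1}.
  have hB : X 2 * L (k + 1) + (-1 : ℂ) ^ k • (L (k + 1) * X 2) =
      q • (X 3 * L' k) - q⁻¹ • (L' k * X 3) := by
    match k with
    | 0 =>
      have := h.theta_smul_L'_zero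
      rw [← h.mul_L'_zero_comm, ← sub_smul, ← mul_smul_comm (q - q⁻¹), this, h.X_three]
      simp
    | 1 =>
      rw [h.L'_one, ← h.X_two_comm_L_two]
      simp only [Nat.reduceAdd]
      module
    | k + 2 =>
      rw [← h.X_two_comm_L_of_commute k (ih (k + 1) (by omega)), pow_add]
      norm_num
  have hC' := h.commute_L' k fun m hm => ih m (by omega)
  have hX3 := h.X_add_two 0
  refine D.commute_of _ _ ?_ ?_
  · simp [D.d₁_mul, h.d₁_L_one D, h.d₁_L D]
  -- Differentiating L₁² gives a multiple of X₂, hence the left side of `hB`; differentiating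
  -- L_{k+1} and commuting with L₁² turns X₁ into X₃, hence its right side.
  · rw [map_sub, D.d₂_mul, D.d₂_mul _ (L 1 * L 1), h.d₂_L_one_sq D, h.t₂_L D,
      h.d₂_L D k fun m hm => ih m (by omega), D.t₂_mul, h.t₂_L_one D]
    rcases neg_one_pow_eq_or ℂ k with hs | hs <;> rw [hs] at hB ⊢
    · linear_combination (norm := skip) (1 - q⁻¹ ^ 2) • hB
        + (q - q⁻¹) • (X 1 * hC' - q⁻¹ ^ 2 • (hC' * X 1) + hX3 * L' k - q⁻¹ ^ 2 • (L' k * hX3))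
      simp only [mul_add, add_mul, mul_sub, sub_mul, smul_mul_assoc, mul_smul_comm, mul_assoc,
        mul_neg, neg_mul, Nat.reduceAdd, Nat.zero_add]
      match_scalars <;> field_simp <;> ring
    · linear_combination (norm := skip) -(1 - q⁻¹ ^ 2) • hB
        - (q - q⁻¹) • (X 1 * hC' - q⁻¹ ^ 2 • (hC' * X 1) + hX3 * L' k - q⁻¹ ^ 2 • (L' k * hX3))
      simp only [mul_add, add_mul, mul_sub, sub_mul, smul_mul_assoc, mul_smul_comm, mul_assoc,
        mul_neg, neg_mul, Nat.reduceAdd, Nat.zero_add]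
      match_scalars <;> field_simp <;> ring

end RootVectors

end SquareCommutes

end DiagonalNichols

namespace DiagonalNichols

/-! ### Solving the recursions -/

section ClosedForms

variable {A : Type*} [Ring A] [Algebra ℂ A]

theorem polyQ_eq (q : ℂ) (k : ℕ) :
    polyQ q k = (-1) ^ k * polyP q k + q ^ k - (-1) ^ k * q ^ k := by
  induction k with
  | zero => simp [polyP, polyQ]
  | succ k ih =>
    rw [polyQ, polyP, ih]
    rcases neg_one_pow_eq_or ℂ k with hs | hs <;> simp only [pow_succ, hs] <;> ring

/-- With `polyQ_add_two`, the form in which P and Q enter: the coefficients match those of the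
q-commutations of X₁, X₃ and of X₂, X₄. -/
theorem polyP_add_two (q : ℂ) (k : ℕ) :
    polyP q (k + 2) = q * polyP q k + (1 + q) * polyQ q (k + 1) := by
  rw [polyQ_eq, polyP, polyP]
  rcases neg_one_pow_eq_or ℂ k with hs | hs <;> simp only [pow_succ, hs] <;> ring

theorem polyQ_add_two (q : ℂ) (k : ℕ) :
    polyQ q (k + 2) = -q * polyQ q k + (q - 1) * polyP q (k + 1) := by
  rw [polyQ_eq, polyQ_eq, polyP, polyP]
  rcases neg_one_pow_eq_or ℂ k with hs | hs <;> simp only [pow_succ, hs] <;> ring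

theorem polyP_neg (q : ℂ) (k : ℕ) : polyP (-q) k = (-1) ^ k * polyQ q k := by
  induction k with
  | zero => simp [polyP, polyQ]
  | succ k ih =>
    rw [polyQ, polyP, ih, neg_pow q k, neg_pow q (k + 1)]
    rcases neg_one_pow_eq_or ℂ k with hs | hs <;> simp only [pow_succ, hs] <;> ring

/-- Each step shifts the old terms by two, multiplies them by q², and adds the terms with i = m. The
offset c is 0 for X₁, Y₁ and 1 for X₂, Y₂; s is the sign of the second sum. -/
theorem closed_form_pow {q θ s : ℂ} {c : ℕ} (Δ : A →ₗ[ℂ] A) (E O : ℕ → ℕ → A)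
    (hE : ∀ i k, Δ (E i (k + 1)) = E i (k + 3)) (hO : ∀ i k, Δ (O i (k + 1)) = O i (k + 3))
    (F : ℕ → A) (h0 : F 0 = 0)
    (hF : ∀ m, F (m + 1) =
      q ^ 2 • Δ (F m) + (q * θ) • E m (c + 3) + (s * θ) • O m (c + 2)) (n : ℕ) :
    F n = (∑ i ∈ Finset.range n, (q ^ (2 * n - 1 - 2 * i) * θ) • E i (2 * n + 1 + c - 2 * i)) +
      s • ∑ i ∈ Finset.range n, (q ^ (2 * n - 2 - 2 * i) * θ) • O i (2 * n + c - 2 * i) := by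
  induction n with
  | zero => simp [h0]
  | succ n ih =>
    rw [hF, ih, Finset.sum_range_succ, Finset.sum_range_succ, map_add, map_smul, map_sum, map_sum]
    have e1 : q ^ 2 • ∑ i ∈ Finset.range n,
        Δ ((q ^ (2 * n - 1 - 2 * i) * θ) • E i (2 * n + 1 + c - 2 * i)) =
        ∑ i ∈ Finset.range n,
          (q ^ (2 * (n + 1) - 1 - 2 * i) * θ) • E i (2 * (n + 1) + 1 + c - 2 * i) := by
      rw [Finset.smul_sum]
      refine Finset.sum_congr rfl fun i hi => ?_
      have hi := Finset.mem_range.mp hi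
      -- The shift applies only to positive indices; i < n ensures this and keeps every subtraction
      -- exact.
      rw [map_smul, show 2 * n + 1 + c - 2 * i = (2 * n + c - 2 * i) + 1 by omega, hE, smul_smul,
        show 2 * (n + 1) - 1 - 2 * i = (2 * n - 1 - 2 * i) + 2 by omega,
        show 2 * (n + 1) + 1 + c - 2 * i = (2 * n + c - 2 * i) + 3 by omega]
      congr 1
      ring
    have e2 : q ^ 2 • ∑ i ∈ Finset.range n,
        Δ ((q ^ (2 * n - 2 - 2 * i) * θ) • O i (2 * n + c - 2 * i)) =
        ∑ i ∈ Finset.range n,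
          (q ^ (2 * (n + 1) - 2 - 2 * i) * θ) • O i (2 * (n + 1) + c - 2 * i) := by
      rw [Finset.smul_sum]
      refine Finset.sum_congr rfl fun i hi => ?_
      have hi := Finset.mem_range.mp hi
      rw [map_smul, show 2 * n + c - 2 * i = (2 * n + c - 2 * i - 1) + 1 by omega, hO, smul_smul,
        show 2 * (n + 1) - 2 - 2 * i = (2 * n - 2 - 2 * i) + 2 by omega,
        show 2 * (n + 1) + c - 2 * i = (2 * n + c - 2 * i - 1) + 3 by omega]
      congr 1
      ring
    rw [smul_add, smul_comm (q ^ 2) s, e1, e2, show 2 * (n + 1) - 1 - 2 * n = 1 by omega,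
      show 2 * (n + 1) - 2 - 2 * n = 0 by omega,
      show 2 * (n + 1) + 1 + c - 2 * n = c + 3 by omega,
      show 2 * (n + 1) + c - 2 * n = c + 2 by omega]
    module

/-- G is an auxiliary sequence built from the L's of odd index. The induction carries both formulas,
passing from F n, G n to F (n + 1) and then to G (n + 1) by the two-step recursions of P and Q. -/
theorem closed_form_polyP {q θ : ℂ} {c : ℕ} (Δ : A →ₗ[ℂ] A) (E O : ℕ → ℕ → A)
    (hE : ∀ i k, Δ (E i (k + 1)) = E i (k + 3)) (hO : ∀ i k, Δ (O i (k + 1)) = O i (k + 3))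
    (F G : ℕ → A) (h0 : F 0 = 0) (hG1 : G 0 = θ • E 0 (c + 3))
    (hG : ∀ m, G (m + 1) = -q • Δ (G m) + (q - 1) • Δ (F (m + 1)) + θ • O m (c + 4) +
      θ • E (m + 1) (c + 3))
    (hF : ∀ m, F (m + 1) =
      q • Δ (F m) + (1 + q) • G m + θ • E m (c + 3) - θ • O m (c + 2)) (n : ℕ) :
    F n = (∑ i ∈ Finset.range n, (polyP q (2 * n - 1 - 2 * i) * θ) • E i (2 * n + 1 + c - 2 * i)) -
        ∑ i ∈ Finset.range n, (polyP q (2 * n - 2 - 2 * i) * θ) • O i (2 * n + c - 2 * i) ∧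
    G n = (∑ i ∈ Finset.range (n + 1),
          (polyQ q (2 * n - 2 * i) * θ) • E i (2 * n + 3 + c - 2 * i)) -
        ∑ i ∈ Finset.range n, (polyQ q (2 * n - 1 - 2 * i) * θ) • O i (2 * n + 2 + c - 2 * i) := by
  have step : ∀ n,
      F n = (∑ i ∈ Finset.range n,
          (polyP q (2 * n - 1 - 2 * i) * θ) • E i (2 * n + 1 + c - 2 * i)) -
        ∑ i ∈ Finset.range n, (polyP q (2 * n - 2 - 2 * i) * θ) • O i (2 * n + c - 2 * i) →
      G n = (∑ i ∈ Finset.range (n + 1),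
          (polyQ q (2 * n - 2 * i) * θ) • E i (2 * n + 3 + c - 2 * i)) -
        ∑ i ∈ Finset.range n, (polyQ q (2 * n - 1 - 2 * i) * θ) • O i (2 * n + 2 + c - 2 * i) →
      F (n + 1) = (∑ i ∈ Finset.range (n + 1),
          (polyP q (2 * (n + 1) - 1 - 2 * i) * θ) • E i (2 * (n + 1) + 1 + c - 2 * i)) -
        ∑ i ∈ Finset.range (n + 1),
          (polyP q (2 * (n + 1) - 2 - 2 * i) * θ) • O i (2 * (n + 1) + c - 2 * i) := by
    intro n hFn hGn
    rw [hF, hFn, hGn, Finset.sum_range_succ, Finset.sum_range_succ, Finset.sum_range_succ]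
    have e1 : ∑ i ∈ Finset.range n,
        (polyP q (2 * (n + 1) - 1 - 2 * i) * θ) • E i (2 * (n + 1) + 1 + c - 2 * i) =
        q • Δ (∑ i ∈ Finset.range n,
          (polyP q (2 * n - 1 - 2 * i) * θ) • E i (2 * n + 1 + c - 2 * i)) +
        (1 + q) • ∑ i ∈ Finset.range n,
          (polyQ q (2 * n - 2 * i) * θ) • E i (2 * n + 3 + c - 2 * i) := by
      rw [map_sum, Finset.smul_sum, Finset.smul_sum, ← Finset.sum_add_distrib]
      refine Finset.sum_congr rfl fun i hi => ?_
      have hi := Finset.mem_range.mp hi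
      rw [map_smul, show 2 * n + 1 + c - 2 * i = (2 * n + c - 2 * i) + 1 by omega, hE,
        show 2 * (n + 1) - 1 - 2 * i = (2 * n - 1 - 2 * i) + 2 by omega, polyP_add_two,
        show 2 * n - 2 * i = (2 * n - 1 - 2 * i) + 1 by omega,
        show 2 * (n + 1) + 1 + c - 2 * i = (2 * n + c - 2 * i) + 3 by omega,
        show 2 * n + 3 + c - 2 * i = (2 * n + c - 2 * i) + 3 by omega]
      module
    have e2 : ∑ i ∈ Finset.range n,
        (polyP q (2 * (n + 1) - 2 - 2 * i) * θ) • O i (2 * (n + 1) + c - 2 * i) =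
        q • Δ (∑ i ∈ Finset.range n,
          (polyP q (2 * n - 2 - 2 * i) * θ) • O i (2 * n + c - 2 * i)) +
        (1 + q) • ∑ i ∈ Finset.range n,
          (polyQ q (2 * n - 1 - 2 * i) * θ) • O i (2 * n + 2 + c - 2 * i) := by
      rw [map_sum, Finset.smul_sum, Finset.smul_sum, ← Finset.sum_add_distrib]
      refine Finset.sum_congr rfl fun i hi => ?_
      have hi := Finset.mem_range.mp hi
      rw [map_smul, show 2 * n + c - 2 * i = (2 * n + c - 2 * i - 1) + 1 by omega, hO,
        show 2 * (n + 1) - 2 - 2 * i = (2 * n - 2 - 2 * i) + 2 by omega, polyP_add_two,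
        show 2 * n - 1 - 2 * i = (2 * n - 2 - 2 * i) + 1 by omega,
        show 2 * (n + 1) + c - 2 * i = (2 * n + c - 2 * i - 1) + 3 by omega,
        show 2 * n + 2 + c - 2 * i = (2 * n + c - 2 * i - 1) + 3 by omega]
      module
    rw [e1, e2, show 2 * (n + 1) - 1 - 2 * n = 1 by omega,
      show 2 * (n + 1) - 2 - 2 * n = 0 by omega, show 2 * n - 2 * n = 0 by omega,
      show 2 * (n + 1) + 1 + c - 2 * n = c + 3 by omega,
      show 2 * (n + 1) + c - 2 * n = c + 2 by omega,
      show 2 * n + 3 + c - 2 * n = c + 3 by omega, map_sub]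
    simp only [polyP, polyQ]
    module
  induction n with
  | zero => exact ⟨by simp [h0], by simpa [polyQ, add_comm] using hG1⟩
  | succ n ih =>
    obtain ⟨hFn, hGn⟩ := ih
    have hFs := step n hFn hGn
    refine ⟨hFs, ?_⟩
    rw [hG, hFs, hGn, Finset.sum_range_succ _ (n + 1)]
    have e1 : ∑ i ∈ Finset.range (n + 1),
        (polyQ q (2 * (n + 1) - 2 * i) * θ) • E i (2 * (n + 1) + 3 + c - 2 * i) =
        -q • Δ (∑ i ∈ Finset.range (n + 1),
          (polyQ q (2 * n - 2 * i) * θ) • E i (2 * n + 3 + c - 2 * i)) +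
        (q - 1) • Δ (∑ i ∈ Finset.range (n + 1),
          (polyP q (2 * (n + 1) - 1 - 2 * i) * θ) • E i (2 * (n + 1) + 1 + c - 2 * i)) := by
      rw [map_sum, map_sum, Finset.smul_sum, Finset.smul_sum, ← Finset.sum_add_distrib]
      refine Finset.sum_congr rfl fun i hi => ?_
      have hi := Finset.mem_range.mp hi
      rw [map_smul, map_smul, show 2 * n + 3 + c - 2 * i = (2 * n + 2 + c - 2 * i) + 1 by omega,
        show 2 * (n + 1) + 1 + c - 2 * i = (2 * n + 2 + c - 2 * i) + 1 by omega, hE,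
        show 2 * (n + 1) - 2 * i = (2 * n - 2 * i) + 2 by omega, polyQ_add_two,
        show 2 * (n + 1) - 1 - 2 * i = (2 * n - 2 * i) + 1 by omega,
        show 2 * (n + 1) + 3 + c - 2 * i = (2 * n + 2 + c - 2 * i) + 3 by omega]
      module
    have e2 : ∑ i ∈ Finset.range n,
        (polyQ q (2 * (n + 1) - 1 - 2 * i) * θ) • O i (2 * (n + 1) + 2 + c - 2 * i) =
        -q • Δ (∑ i ∈ Finset.range n,
          (polyQ q (2 * n - 1 - 2 * i) * θ) • O i (2 * n + 2 + c - 2 * i)) +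
        (q - 1) • Δ (∑ i ∈ Finset.range n,
          (polyP q (2 * (n + 1) - 2 - 2 * i) * θ) • O i (2 * (n + 1) + c - 2 * i)) := by
      rw [map_sum, map_sum, Finset.smul_sum, Finset.smul_sum, ← Finset.sum_add_distrib]
      refine Finset.sum_congr rfl fun i hi => ?_
      have hi := Finset.mem_range.mp hi
      rw [map_smul, map_smul, show 2 * n + 2 + c - 2 * i = (2 * n + 1 + c - 2 * i) + 1 by omega,
        show 2 * (n + 1) + c - 2 * i = (2 * n + 1 + c - 2 * i) + 1 by omega, hO,
        show 2 * (n + 1) - 1 - 2 * i = (2 * n - 1 - 2 * i) + 2 by omega, polyQ_add_two,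
        show 2 * (n + 1) - 2 - 2 * i = (2 * n - 1 - 2 * i) + 1 by omega,
        show 2 * (n + 1) + 2 + c - 2 * i = (2 * n + 1 + c - 2 * i) + 3 by omega]
      module
    rw [Finset.sum_range_succ (fun i => (polyP q (2 * (n + 1) - 2 - 2 * i) * θ) •
        O i (2 * (n + 1) + c - 2 * i)) n,
      Finset.sum_range_succ (fun i => (polyQ q (2 * (n + 1) - 1 - 2 * i) * θ) •
        O i (2 * (n + 1) + 2 + c - 2 * i)) n, e1, e2,
      show 2 * (n + 1) - 1 - 2 * n = 1 by omega,
      show 2 * (n + 1) - 2 - 2 * n = 0 by omega,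
      show 2 * (n + 1) + c - 2 * n = c + 1 + 1 by omega,
      show 2 * (n + 1) + 2 + c - 2 * n = c + 4 by omega,
      show 2 * (n + 1) - 2 * (n + 1) = 0 by omega,
      show 2 * (n + 1) + 3 + c - 2 * (n + 1) = c + 3 by omega]
    simp only [map_sub, map_add, map_smul, hO, polyP, polyQ]
    module

end ClosedForms

end DiagonalNichols

namespace DiagonalNichols

/-! ### Relations between X₁, X₂ and the L's in all degrees -/

section Relations

set_option linter.unusedSimpArgs false

variable {A : Type*} [Ring A] [Algebra ℂ A] {q : ℂ} {X Y L L' : ℕ → A}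

/-- The commutator with `s`. -/
def commutatorMap (s : A) : A →ₗ[ℂ] A := LinearMap.mulRight ℂ s - LinearMap.mulLeft ℂ s

theorem commutatorMap_apply (s a : A) : commutatorMap s a = a * s - s * a := rfl

theorem commutatorMap_mul (s a b : A) :
    commutatorMap s (a * b) = a * commutatorMap s b + commutatorMap s a * b := by
  simp only [commutatorMap_apply]; noncomm_ring

namespace RootVectors

theorem commute_L'_all (h : RootVectors q X Y L L')
    (hC : ∀ n, L 1 * L 1 * L n = L n * (L 1 * L 1)) (n : ℕ) :
    L 1 * L 1 * L' n = L' n * (L 1 * L 1) := h.commute_L' n fun m _ => hC m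

theorem shift_L (hC : ∀ n, L 1 * L 1 * L n = L n * (L 1 * L 1)) (n : ℕ) :
    commutatorMap (L 1 * L 1) (L n) = 0 := by
  rw [commutatorMap_apply, hC, sub_self]

theorem shift_L' (h : RootVectors q X Y L L')
    (hC : ∀ n, L 1 * L 1 * L n = L n * (L 1 * L 1)) (n : ℕ) :
    commutatorMap (L 1 * L 1) (L' n) = 0 := by
  rw [commutatorMap_apply, h.commute_L'_all hC, sub_self]

theorem shift_X (h : RootVectors q X Y L L') (n : ℕ) :
    commutatorMap (L 1 * L 1) (X (n + 1)) = X (n + 3) := by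
  rw [commutatorMap_apply, h.X_add_two]

theorem shift_Y (h : RootVectors q X Y L L') (n : ℕ) :
    (-commutatorMap (L 1 * L 1)) (Y (n + 1)) = Y (n + 3) := by
  rw [LinearMap.neg_apply, commutatorMap_apply, h.Y_add_two, neg_sub]

theorem shift_mul_X (h : RootVectors q X Y L L') {a : A}
    (ha : commutatorMap (L 1 * L 1) a = 0) (n : ℕ) :
    commutatorMap (L 1 * L 1) (a * X (n + 1)) = a * X (n + 3) := by
  rw [commutatorMap_mul, ha, h.shift_X, zero_mul, add_zero]

theorem shift_X_mul (h : RootVectors q X Y L L') {a : A}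
    (ha : commutatorMap (L 1 * L 1) a = 0) (n : ℕ) :
    commutatorMap (L 1 * L 1) (X (n + 1) * a) = X (n + 3) * a := by
  rw [commutatorMap_mul, ha, h.shift_X, mul_zero, zero_add]

theorem shift_mul_Y (h : RootVectors q X Y L L') {a : A}
    (ha : commutatorMap (L 1 * L 1) a = 0) (n : ℕ) :
    (-commutatorMap (L 1 * L 1)) (a * Y (n + 1)) = a * Y (n + 3) := by
  rw [LinearMap.neg_apply, commutatorMap_mul, ha, zero_mul, add_zero, ← mul_neg,
    ← LinearMap.neg_apply, h.shift_Y]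

theorem shift_Y_mul (h : RootVectors q X Y L L') {a : A}
    (ha : commutatorMap (L 1 * L 1) a = 0) (n : ℕ) :
    (-commutatorMap (L 1 * L 1)) (Y (n + 1) * a) = Y (n + 3) * a := by
  rw [LinearMap.neg_apply, commutatorMap_mul, ha, mul_zero, zero_add, ← neg_mul,
    ← LinearMap.neg_apply, h.shift_Y]

/-- Once L₁² commutes with the L's, `pairing_shift` lets two units move freely between the indices
of X and Y. -/
theorem pairing_odd (h : RootVectors q X Y L L')
    (hC : ∀ n, L 1 * L 1 * L n = L n * (L 1 * L 1)) (k b : ℕ) :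
    pairing q X Y (2 * k + 1) (b + 1) = L (2 * k + b + 1) := by
  induction k generalizing b with
  | zero => rw [show 2 * 0 + b + 1 = b + 1 by ring]; exact h.pairing_one b
  | succ k ih =>
    have := h.pairing_shift (2 * k) b
    rw [ih (b + 2), ih b, hC, sub_self, sub_eq_zero] at this
    rw [show 2 * (k + 1) + 1 = 2 * k + 3 by ring, this]
    congr 1
    ring

theorem pairing_even (h : RootVectors q X Y L L')
    (hC : ∀ n, L 1 * L 1 * L n = L n * (L 1 * L 1)) (k b : ℕ) :
    pairing q X Y (2 * k + 2) (b + 1) = L' (2 * k + b + 2) := by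
  induction k generalizing b with
  | zero => rw [show 2 * 0 + b + 2 = b + 2 by ring]; exact h.pairing_two b
  | succ k ih =>
    have := h.pairing_shift (2 * k + 1) b
    rw [ih (b + 2), ih b, h.commute_L'_all hC, sub_self, sub_eq_zero] at this
    rw [show 2 * (k + 1) + 2 = 2 * k + 1 + 3 by ring, this]
    congr 1
    ring

theorem L_eq_odd (h : RootVectors q X Y L L')
    (hC : ∀ n, L 1 * L 1 * L n = L n * (L 1 * L 1)) (k b : ℕ) :
    L (2 * k + b + 1) = X (2 * k + 1) * Y (b + 1) - (1 * q⁻¹) • (Y (b + 1) * X (2 * k + 1)) := by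
  rw [← h.pairing_odd hC, pairing, show (2 * k + 1 + 1) * (b + 1) = 2 * ((k + 1) * (b + 1)) by ring,
    pow_mul]
  norm_num

theorem L'_eq_even (h : RootVectors q X Y L L')
    (hC : ∀ n, L 1 * L 1 * L n = L n * (L 1 * L 1)) (k b : ℕ) :
    L' (2 * k + b + 2) = X (2 * k + 2) * Y (b + 1) -
      (-(-1) ^ b * q⁻¹) • (Y (b + 1) * X (2 * k + 2)) := by
  rw [← h.pairing_even hC, pairing,
    show (2 * k + 2 + 1) * (b + 1) = 2 * ((k + 1) * (b + 1)) + (b + 1) by ring, pow_add, pow_mul]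
  norm_num [pow_succ]

theorem X_two_mul_X_four (h : RootVectors q X Y L L') :
    X 2 * X 4 = (-1 * q) • (X 4 * X 2) + (q - 1) • (X 3 * X 3) := by
  linear_combination (norm := skip) h.X_two_mul_X_three * L 1 + L 1 * h.X_two_mul_X_three
    + X 2 * h.X_four + h.X_three * X 3 + q • (h.X_four * X 2) - q • (X 3 * h.X_three)
  simp only [mul_add, add_mul, mul_sub, sub_mul, smul_mul_assoc, mul_smul_comm, mul_assoc]
  module

theorem Y_four_mul_Y_two (h : RootVectors q X Y L L') :
    Y 4 * Y 2 = (1 * q) • (Y 2 * Y 4) + (1 + q) • (Y 3 * Y 3) := by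
  linear_combination (norm := skip) L 1 * h.Y_three_mul_Y_two + h.Y_three_mul_Y_two * L 1
    + h.Y_four * Y 2 - q • (Y 2 * h.Y_four) - Y 3 * h.Y_three - q • (h.Y_three * Y 3)
  simp only [mul_add, add_mul, mul_sub, sub_mul, smul_mul_assoc, mul_smul_comm, mul_assoc]
  module

theorem X_one_comm_L' (h : RootVectors q X Y L L') (n : ℕ) :
    X 1 * L' (n + 1) - L' (n + 1) * X 1 =
      q • (X 2 * L n) - ((-1) ^ n * q⁻¹) • (L n * X 2) := by
  cases n with
  | zero =>
    rw [← h.mul_L_zero_comm, pow_zero, one_mul, ← sub_smul, ← mul_smul_comm (q - q⁻¹),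
      h.theta_smul_L_zero, zero_add, h.L'_one, h.X_two, mul_one]
  | succ n =>
    have hM : L (n + 1) = X 1 * Y (n + 1) - (1 * q⁻¹) • (Y (n + 1) * X 1) := by
      rw [h.L_succ, one_mul]
    have hN : L' (n + 2) = X 2 * Y (n + 1) - (-(-1) ^ n * q⁻¹) • (Y (n + 1) * X 2) := by
      rw [h.L'_succ]; module
    rw [pow_succ]
    linear_combination (norm := module) left_pairing_comm h.q_ne_zero h.serre_X hM hN

theorem X_two_comm_L (h : RootVectors q X Y L L')
    (hC : ∀ n, L 1 * L 1 * L n = L n * (L 1 * L 1)) (k : ℕ) :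
    X 2 * L (k + 1) + (-1 : ℂ) ^ k • (L (k + 1) * X 2) =
      q • (X 3 * L' k) - q⁻¹ • (L' k * X 3) := by
  match k with
  | 0 =>
    have := h.theta_smul_L'_zero
    rw [← h.mul_L'_zero_comm, ← sub_smul, ← mul_smul_comm (q - q⁻¹), this, h.X_three]
    simp
  | 1 =>
    rw [h.L'_one, ← h.X_two_comm_L_two]
    simp only [Nat.reduceAdd]
    module
  | k + 2 =>
    rw [← h.X_two_comm_L_of_commute k (hC (k + 1)), pow_add]
    norm_num

/-- The relation between X₁ and X₃, bracketed with Y_n; the index-zero case is separate because L₀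
is a scalar, not a bracket. -/
theorem X_one_comm_L (h : RootVectors q X Y L L')
    (hC : ∀ n, L 1 * L 1 * L n = L n * (L 1 * L 1)) (n : ℕ) :
    X 1 * L (n + 2) - L (n + 2) * X 1 = q • (X 3 * L n) - q⁻¹ • (L n * X 3) +
      (1 + q) • (X 2 * L' (n + 1) + ((-1) ^ n * q⁻¹) • (L' (n + 1) * X 2)) := by
  have hq := h.q_ne_zero
  cases n with
  | zero =>
    rw [← h.mul_L_zero_comm, ← sub_smul, ← mul_smul_comm (q - q⁻¹), h.theta_smul_L_zero]
    simp only [zero_add, h.L'_one, pow_zero, one_mul, mul_one]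
    linear_combination (norm := skip) h.X_one_comm_L_two + (1 + q) • h.X_three
    match_scalars <;> field_simp <;> ring
  | succ n =>
    have hM : L (n + 1) = X 1 * Y (n + 1) - (1 * q⁻¹) • (Y (n + 1) * X 1) := by
      rw [h.L_succ, one_mul]
    have hN : L (n + 3) = X 3 * Y (n + 1) - (1 * q⁻¹) • (Y (n + 1) * X 3) := by
      rw [← h.L_eq_odd hC 1 n]; congr 1; ring
    have hK : L' (n + 2) = X 2 * Y (n + 1) - (-(-1) ^ n * q⁻¹) • (Y (n + 1) * X 2) := by
      rw [h.L'_succ]; module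
    have h1 : X 1 * X 3 = (1 * q) • (X 3 * X 1) + (1 + q) • (X 2 * X 2) := by
      rw [one_mul]; exact h.X_one_mul_X_three
    rw [pow_succ]
    linear_combination (norm := module) left_pairing_comm_sq hq (by norm_num)
      (by rcases neg_one_pow_eq_or ℂ n with hs | hs <;> rw [hs] <;> norm_num) h1 hM hN hK

/-- The case that `left_pairing_comm_sq` misses, since L'₁ is not a bracket with X₂. It is derived
from the relation for L₃ by substituting L₃ = L'₃ + [L₁, L₂]. -/
theorem X_two_comm_L'_three (h : RootVectors q X Y L L') :
    X 2 * L' 3 + L' 3 * X 2 = -q • (X 4 * L 1) - q⁻¹ • (L 1 * X 4) +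
      (q - 1) • (X 3 * L 2 + q⁻¹ • (L 2 * X 3)) := by
  have hq := h.q_ne_zero
  have hB3 := h.X_two_comm_L_of_commute 0 (by rw [zero_add, mul_assoc])
  have h3 := h.X_three
  have h4 := h.X_four
  have h5 := h.X_succ 3
  have h5' := h.X_add_two 2
  have hL2 := h.L_two
  have hL3 := h.L_three
  have hB2 := h.X_two_comm_L_two
  linear_combination (norm := skip) hB3 - (X 2 * hL3 + hL3 * X 2) + h3 * L 2 + L 1 * hB2
    + hB2 * L 1 - L 2 * h3 - (q - q⁻¹) • (L 1 * h4) + q • h5' - q • (X 3 * hL2)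
    + q⁻¹ • (hL2 * X 3) - q • h5
  simp only [mul_add, add_mul, mul_sub, sub_mul, smul_mul_assoc, mul_smul_comm, mul_assoc,
    Nat.reduceAdd, zero_add]
  match_scalars <;> field_simp <;> ring

theorem X_two_comm_L' (h : RootVectors q X Y L L')
    (hC : ∀ n, L 1 * L 1 * L n = L n * (L 1 * L 1)) (n : ℕ) :
    X 2 * L' (n + 2) - (-1 : ℂ) ^ n • (L' (n + 2) * X 2) =
      -q • (X 4 * L' n) + ((-1) ^ n * q⁻¹) • (L' n * X 4) +
      (q - 1) • (X 3 * L (n + 1) + q⁻¹ • (L (n + 1) * X 3)) := by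
  have hq := h.q_ne_zero
  match n with
  | 0 =>
    have e : X 2 * L' 2 - L' 2 * X 2 = (q - 2) • X 4 + (q - q⁻¹) • (L 1 * X 3) := by
      linear_combination (norm := skip) h.X_two_comm_L_two - X 2 * h.L_two + h.L_two * X 2
        + (2 : ℂ) • h.X_add_two 1 - q • h.X_four
      simp only [mul_add, add_mul, mul_sub, sub_mul, smul_mul_assoc, mul_smul_comm, mul_assoc,
        Nat.reduceAdd]
      module
    have e0 : -q • (X 4 * L' 0) + ((-1) ^ 0 * q⁻¹) • (L' 0 * X 4) = -X 4 := by
      rw [← h.mul_L'_zero_comm, ← add_smul, ← mul_smul_comm, pow_zero, one_mul,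
        show -q + q⁻¹ = -(q - q⁻¹) by ring, neg_smul, h.theta_smul_L'_zero, mul_neg, mul_one]
    rw [e0]
    simp only [zero_add, pow_zero, one_smul]
    linear_combination (norm := skip) e + (q - 1) • h.X_four
    match_scalars <;> field_simp <;> ring
  | 1 =>
    have e := h.X_two_comm_L'_three
    simp only [Nat.reduceAdd, h.L'_one, pow_one]
    linear_combination (norm := module) e
  | n + 2 =>
    have hM : L' (n + 2) = X 2 * Y (n + 1) - (-(-1) ^ n * q⁻¹) • (Y (n + 1) * X 2) := by
      rw [h.L'_succ]; module
    have hN : L' (n + 4) = X 4 * Y (n + 1) - (-(-1) ^ n * q⁻¹) • (Y (n + 1) * X 4) := by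
      rw [← h.L'_eq_even hC 1 n]; congr 1; ring
    have hK : L (n + 3) = X 3 * Y (n + 1) - (1 * q⁻¹) • (Y (n + 1) * X 3) := by
      rw [← h.L_eq_odd hC 1 n]; congr 1; ring
    have := left_pairing_comm_sq hq
      (by rcases neg_one_pow_eq_or ℂ n with hs | hs <;> rw [hs] <;> norm_num) (by norm_num)
      h.X_two_mul_X_four hM hN hK
    simp only [pow_succ]
    linear_combination (norm := module) this

end RootVectors

end Relations

end DiagonalNichols

namespace DiagonalNichols

/-! ### Relations between Y₁, Y₂ and the L's in all degrees -/

section Relations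

set_option linter.unusedSimpArgs false

variable {A : Type*} [Ring A] [Algebra ℂ A] {q : ℂ} {X Y L L' : ℕ → A}

namespace RootVectors

/-- L_{2m+1} and L_{2m+2} are the brackets of one X_{2m+1} with Y₁ and Y₂, so the Serre relation for
Y suffices in every degree. The relations below follow the same pattern. -/
theorem L_even_comm_Y_one (h : RootVectors q X Y L L')
    (hC : ∀ n, L 1 * L 1 * L n = L n * (L 1 * L 1)) (m : ℕ) :
    L (2 * m + 2) * Y 1 - Y 1 * L (2 * m + 2) =
      q • (L (2 * m + 1) * Y 2) - q⁻¹ • (Y 2 * L (2 * m + 1)) := by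
  linear_combination (norm := skip)
    right_pairing_comm h.q_ne_zero h.serre_Y (h.L_eq_odd hC m 0) (h.L_eq_odd hC m 1)
  simp only [add_assoc, Nat.reduceAdd, zero_add, add_zero]
  module

theorem L_odd_comm_Y_two (h : RootVectors q X Y L L')
    (hC : ∀ n, L 1 * L 1 * L n = L n * (L 1 * L 1)) (m : ℕ) :
    L (2 * m + 1) * Y 2 - Y 2 * L (2 * m + 1) =
      q • (L (2 * m) * Y 3) - q⁻¹ • (Y 3 * L (2 * m)) := by
  cases m with
  | zero =>
    rw [h.mul_L_zero_comm (Y 3), ← sub_smul, ← smul_mul_assoc, h.theta_smul_L_zero, one_mul,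
      h.Y_three]
  | succ k =>
    linear_combination (norm := skip)
      right_pairing_comm h.q_ne_zero h.Y_three_mul_Y_two (h.L_eq_odd hC k 1) (h.L_eq_odd hC k 2)
    simp only [mul_add, add_assoc, Nat.reduceAdd, Nat.reduceMul, zero_add, add_zero]
    module

theorem L'_odd_comm_Y_one (h : RootVectors q X Y L L')
    (hC : ∀ n, L 1 * L 1 * L n = L n * (L 1 * L 1)) (m : ℕ) :
    L' (2 * m + 1) * Y 1 + Y 1 * L' (2 * m + 1) =
      q • (L' (2 * m) * Y 2) - q⁻¹ • (Y 2 * L' (2 * m)) := by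
  cases m with
  | zero =>
    rw [h.mul_L'_zero_comm (Y 2), ← sub_smul, ← smul_mul_assoc, h.theta_smul_L'_zero, one_mul,
      h.L'_one, h.Y_two]
  | succ k =>
    linear_combination (norm := skip)
      right_pairing_comm h.q_ne_zero h.serre_Y (h.L'_eq_even hC k 0) (h.L'_eq_even hC k 1)
    simp only [mul_add, add_assoc, Nat.reduceAdd, Nat.reduceMul, zero_add, add_zero]
    module

theorem L'_even_comm_Y_two (h : RootVectors q X Y L L')
    (hC : ∀ n, L 1 * L 1 * L n = L n * (L 1 * L 1)) (m : ℕ) :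
    L' (2 * m + 2) * Y 2 - Y 2 * L' (2 * m + 2) =
      q • (L' (2 * m + 1) * Y 3) + q⁻¹ • (Y 3 * L' (2 * m + 1)) := by
  cases m with
  | zero =>
    simp only [mul_zero, zero_add, h.L'_one]
    exact h.L'_two_comm_Y_two
  | succ k =>
    linear_combination (norm := skip) right_pairing_comm h.q_ne_zero h.Y_three_mul_Y_two
      (h.L'_eq_even hC k 1) (h.L'_eq_even hC k 2)
    simp only [mul_add, add_assoc, Nat.reduceAdd, Nat.reduceMul, zero_add, add_zero]
    module

theorem L_even_comm_Y_two (h : RootVectors q X Y L L')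
    (hC : ∀ n, L 1 * L 1 * L n = L n * (L 1 * L 1)) (m : ℕ) :
    L (2 * m + 2) * Y 2 - Y 2 * L (2 * m + 2) =
      q • (L (2 * m) * Y 4) - q⁻¹ • (Y 4 * L (2 * m)) +
      (1 + q) • (L (2 * m + 1) * Y 3 + q⁻¹ • (Y 3 * L (2 * m + 1))) := by
  have hq := h.q_ne_zero
  cases m with
  | zero =>
    have e0 : q • (L 0 * Y 4) - q⁻¹ • (Y 4 * L 0) = Y 4 := by
      rw [h.mul_L_zero_comm (Y 4), ← sub_smul, ← smul_mul_assoc, h.theta_smul_L_zero, one_mul]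
    simp only [mul_zero, zero_add, e0]
    linear_combination (norm := skip) h.L'_two_comm_Y_two + h.L_two * Y 2 - Y 2 * h.L_two
      - (2 : ℂ) • h.Y_add_two 1 + h.Y_four
    simp only [mul_add, add_mul, mul_sub, sub_mul, smul_mul_assoc, mul_smul_comm, mul_assoc,
      Nat.reduceAdd]
    match_scalars <;> field_simp <;> ring
  | succ k =>
    linear_combination (norm := skip) right_pairing_comm_sq hq (by norm_num) (by norm_num)
      h.Y_four_mul_Y_two (h.L_eq_odd hC k 1) (h.L_eq_odd hC k 3) (h.L_eq_odd hC k 2)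
    simp only [mul_add, add_assoc, Nat.reduceAdd, Nat.reduceMul, zero_add, add_zero]
    module

theorem L_odd_comm_Y_one (h : RootVectors q X Y L L')
    (hC : ∀ n, L 1 * L 1 * L n = L n * (L 1 * L 1)) (m : ℕ) :
    L (2 * m + 3) * Y 1 + Y 1 * L (2 * m + 3) =
      -q • (L (2 * m + 1) * Y 3) - q⁻¹ • (Y 3 * L (2 * m + 1)) +
      (q - 1) • (L (2 * m + 2) * Y 2 + q⁻¹ • (Y 2 * L (2 * m + 2))) := by
  have h1 : Y 3 * Y 1 = (-1 * q) • (Y 1 * Y 3) + (q - 1) • (Y 2 * Y 2) := by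
    rw [h.Y_three_mul_Y_one]; module
  linear_combination (norm := skip) right_pairing_comm_sq h.q_ne_zero (by norm_num) (by norm_num)
    h1 (h.L_eq_odd hC m 0) (h.L_eq_odd hC m 2) (h.L_eq_odd hC m 1)
  simp only [mul_add, add_assoc, Nat.reduceAdd, Nat.reduceMul, zero_add, add_zero]
  module

theorem L'_even_comm_Y_one (h : RootVectors q X Y L L')
    (hC : ∀ n, L 1 * L 1 * L n = L n * (L 1 * L 1)) (m : ℕ) :
    L' (2 * m + 2) * Y 1 - Y 1 * L' (2 * m + 2) =
      -q • (L' (2 * m) * Y 3) + q⁻¹ • (Y 3 * L' (2 * m)) +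
      (q - 1) • (L' (2 * m + 1) * Y 2 + q⁻¹ • (Y 2 * L' (2 * m + 1))) := by
  have hq := h.q_ne_zero
  cases m with
  | zero =>
    have e0 : -q • (L' 0 * Y 3) + q⁻¹ • (Y 3 * L' 0) = -Y 3 := by
      rw [h.mul_L'_zero_comm (Y 3), ← add_smul, show -q + q⁻¹ = -(q - q⁻¹) by ring, neg_smul,
        ← smul_mul_assoc, h.theta_smul_L'_zero, one_mul]
    simp only [mul_zero, zero_add, e0, h.L'_one]
    linear_combination (norm := skip) h.L'_two_comm_Y_one + (q - 1) • h.Y_three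
    match_scalars <;> field_simp <;> ring
  | succ k =>
    have h1 : Y 3 * Y 1 = (-1 * q) • (Y 1 * Y 3) + (q - 1) • (Y 2 * Y 2) := by
      rw [h.Y_three_mul_Y_one]; module
    have hN := h.L'_eq_even hC k 2
    -- The brackets with Y₁ and Y₃ must carry syntactically the same sign m.
    rw [show -(-1 : ℂ) ^ 2 = -(-1) ^ 0 by norm_num] at hN
    linear_combination (norm := skip) right_pairing_comm_sq hq (by norm_num) (by norm_num)
      h1 (h.L'_eq_even hC k 0) hN (h.L'_eq_even hC k 1)
    simp only [mul_add, add_assoc, Nat.reduceAdd, Nat.reduceMul, zero_add, add_zero]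
    module

/-- Base case not covered by brackets with X₂, again because of L'₁; obtained from the relation for
L₃. -/
theorem L'_three_comm_Y_two (h : RootVectors q X Y L L')
    (hC : ∀ n, L 1 * L 1 * L n = L n * (L 1 * L 1)) :
    L' 3 * Y 2 - Y 2 * L' 3 = q • (L 1 * Y 4) - q⁻¹ • (Y 4 * L 1) +
      (1 + q) • (L' 2 * Y 3 - q⁻¹ • (Y 3 * L' 2)) := by
  have hq := h.q_ne_zero
  have hii := h.L_odd_comm_Y_two hC 1
  have h3 := h.Y_three
  have h4 := h.Y_four
  have h5 := h.Y_succ 3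
  have h5' := h.Y_add_two 2
  have hL2 := h.L_two
  have hL3 := h.L_three
  have hb : L 2 * Y 2 - Y 2 * L 2 = (q + 2) • Y 4 - (q - q⁻¹) • (Y 3 * L 1) := by
    linear_combination (norm := skip) h.L'_two_comm_Y_two + hL2 * Y 2 - Y 2 * hL2
      - (2 : ℂ) • h.Y_add_two 1 - q • h.Y_four
    simp only [mul_add, add_mul, mul_sub, sub_mul, smul_mul_assoc, mul_smul_comm, mul_assoc,
      Nat.reduceAdd]
    module
  linear_combination (norm := skip) hii - (hL3 * Y 2 - Y 2 * hL3)
    - (L 1 * hb + L 2 * h3 - hb * L 1 - h3 * L 2) + (q + 2) • h5 - (q - q⁻¹) • (h4 * L 1)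
    + q • h5 + (1 + q) • (hL2 * Y 3 - q⁻¹ • (Y 3 * hL2)) - (2 * (1 + q)) • h5'
  simp only [mul_add, add_mul, mul_sub, sub_mul, smul_mul_assoc, mul_smul_comm, mul_assoc,
    Nat.reduceAdd, Nat.reduceMul, zero_add]
  match_scalars <;> field_simp <;> ring

theorem L'_odd_comm_Y_two (h : RootVectors q X Y L L')
    (hC : ∀ n, L 1 * L 1 * L n = L n * (L 1 * L 1)) (m : ℕ) :
    L' (2 * m + 3) * Y 2 - Y 2 * L' (2 * m + 3) =
      q • (L' (2 * m + 1) * Y 4) - q⁻¹ • (Y 4 * L' (2 * m + 1)) +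
      (1 + q) • (L' (2 * m + 2) * Y 3 - q⁻¹ • (Y 3 * L' (2 * m + 2))) := by
  have hq := h.q_ne_zero
  cases m with
  | zero =>
    simp only [mul_zero, zero_add, h.L'_one]
    exact h.L'_three_comm_Y_two hC
  | succ k =>
    have hN := h.L'_eq_even hC k 3
    rw [show -(-1 : ℂ) ^ 3 = -(-1) ^ 1 by norm_num] at hN
    linear_combination (norm := skip) right_pairing_comm_sq hq (by norm_num) (by norm_num)
      h.Y_four_mul_Y_two (h.L'_eq_even hC k 1) hN (h.L'_eq_even hC k 2)
    simp only [mul_add, add_assoc, Nat.reduceAdd, Nat.reduceMul, zero_add, add_zero]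
    module

end RootVectors

end Relations

end DiagonalNichols

namespace DiagonalNichols

/-! ### The eight relations in closed form -/

section EvenRelations

set_option linter.unusedSimpArgs false

variable {A : Type*} [Ring A] [Algebra ℂ A] {q : ℂ} {X Y L L' : ℕ → A}

/-- By P_k(-q) = (-1)^k Q_k(q), the sign of θ is absorbed where k is odd and turns the difference
into a sum where k is even. -/
theorem sum_polyP_neg (q : ℂ) (c : ℕ) (E O : ℕ → ℕ → A) (n : ℕ) :
    ((∑ i ∈ Finset.range n,
      (polyP (-q) (2 * n - 1 - 2 * i) * -theta q) • E i (2 * n + 1 + c - 2 * i)) -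
      ∑ i ∈ Finset.range n, (polyP (-q) (2 * n - 2 - 2 * i) * -theta q) • O i (2 * n + c - 2 * i)) =
    (∑ i ∈ Finset.range n, (polyQ q (2 * n - 1 - 2 * i) * theta q) • E i (2 * n + 1 + c - 2 * i)) +
      ∑ i ∈ Finset.range n, (polyQ q (2 * n - 2 - 2 * i) * theta q) • O i (2 * n + c - 2 * i) := by
  rw [sub_eq_add_neg, ← Finset.sum_neg_distrib]
  congr 1 <;> refine Finset.sum_congr rfl fun i hi => ?_ <;> have hi := Finset.mem_range.mp hi
  · rw [polyP_neg, Odd.neg_one_pow ⟨n - 1 - i, by omega⟩, neg_one_mul, neg_mul_neg]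
  · rw [polyP_neg, Even.neg_one_pow ⟨n - 1 - i, by omega⟩, one_mul, mul_neg, neg_smul, neg_neg]

namespace RootVectors

/-- The Serre relation rewrites the commutator through X₂ and L_{2m+1}, and X₂X₃ = qX₃X₂ rewrites
that through X₃ and L'_{2m}, which is Δ of the previous commutator. Reordering leaves the two terms
with θ. -/
theorem X_one_comm_L'_even (h : RootVectors q X Y L L')
    (hC : ∀ n, L 1 * L 1 * L n = L n * (L 1 * L 1)) (n : ℕ) :
    X 1 * L' (2 * n) - L' (2 * n) * X 1 =
      (∑ i ∈ Finset.range n,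
        (q ^ (2 * n - 1 - 2 * i) * theta q) • (L' (2 * i) * X (2 * n + 1 - 2 * i))) -
      ∑ i ∈ Finset.range n,
        (q ^ (2 * n - 2 - 2 * i) * theta q) • (L (2 * i + 1) * X (2 * n - 2 * i)) := by
  have hq := h.q_ne_zero
  have key := closed_form_pow (q := q) (θ := theta q) (s := -1) (c := 0) (commutatorMap (L 1 * L 1))
    (fun i k => L' (2 * i) * X k) (fun i k => L (2 * i + 1) * X k)
    (fun i k => h.shift_mul_X (h.shift_L' hC _) _) (fun i k => h.shift_mul_X (shift_L hC _) _)
    (fun m => X 1 * L' (2 * m) - L' (2 * m) * X 1) (by simp [h.L_zero, h.L'_zero]) ?_ n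
  · simpa [sub_eq_add_neg, add_assoc] using key
  intro m
  have e1 := h.X_one_comm_L' (2 * m + 1)
  have e2 := h.X_two_comm_L hC (2 * m)
  simp only [map_sub, map_add, map_smul, h.shift_mul_X (shift_L hC _),
    h.shift_X_mul (shift_L hC _), h.shift_mul_X (h.shift_L' hC _), h.shift_X_mul (h.shift_L' hC _),
    zero_add, Nat.reduceAdd, pow_succ, pow_mul, one_pow, neg_one_sq] at e1 e2 ⊢
  linear_combination (norm := skip) e1 + q • e2
  simp only [theta, mul_add, mul_one, zero_add, Nat.reduceAdd, add_assoc]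
  match_scalars <;> field_simp <;> ring

theorem X_two_comm_L_even (h : RootVectors q X Y L L')
    (hC : ∀ n, L 1 * L 1 * L n = L n * (L 1 * L 1)) (n : ℕ) :
    X 2 * L (2 * n) - L (2 * n) * X 2 =
      (∑ i ∈ Finset.range n,
        (q ^ (2 * n - 1 - 2 * i) * theta q) • (L (2 * i) * X (2 * n + 2 - 2 * i))) +
      ∑ i ∈ Finset.range n,
        (q ^ (2 * n - 2 - 2 * i) * theta q) • (L' (2 * i + 1) * X (2 * n + 1 - 2 * i)) := by
  have hq := h.q_ne_zero
  have key := closed_form_pow (q := q) (θ := theta q) (s := 1) (c := 1) (commutatorMap (L 1 * L 1))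
    (fun i k => L (2 * i) * X k) (fun i k => L' (2 * i + 1) * X k)
    (fun i k => h.shift_mul_X (shift_L hC _) _) (fun i k => h.shift_mul_X (h.shift_L' hC _) _)
    (fun m => X 2 * L (2 * m) - L (2 * m) * X 2) (by simp [h.L_zero, h.L'_zero]) ?_ n
  · simpa [sub_eq_add_neg, add_assoc] using key
  intro m
  have e1 := h.X_two_comm_L hC (2 * m + 1)
  -- The bracket of X₃ with L'_{2m+1} is the shift of the one with X₁.
  have e2 := congrArg (commutatorMap (L 1 * L 1)) (h.X_one_comm_L' (2 * m))
  simp only [map_sub, map_add, map_smul, h.shift_mul_X (shift_L hC _),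
    h.shift_X_mul (shift_L hC _), h.shift_mul_X (h.shift_L' hC _), h.shift_X_mul (h.shift_L' hC _),
    zero_add, Nat.reduceAdd, pow_succ, pow_mul, one_pow, neg_one_sq] at e1 e2 ⊢
  linear_combination (norm := skip) e1 + q • e2
  simp only [theta, mul_add, mul_one, zero_add, Nat.reduceAdd, add_assoc]
  match_scalars <;> field_simp <;> ring

theorem L_even_comm_Y_one_eq (h : RootVectors q X Y L L')
    (hC : ∀ n, L 1 * L 1 * L n = L n * (L 1 * L 1)) (n : ℕ) :
    L (2 * n) * Y 1 - Y 1 * L (2 * n) =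
      (∑ i ∈ Finset.range n,
        (q ^ (2 * n - 1 - 2 * i) * theta q) • (Y (2 * n + 1 - 2 * i) * L (2 * i))) +
      ∑ i ∈ Finset.range n,
        (q ^ (2 * n - 2 - 2 * i) * theta q) • (Y (2 * n - 2 * i) * L (2 * i + 1)) := by
  have hq := h.q_ne_zero
  have key := closed_form_pow (q := q) (θ := theta q) (s := 1) (c := 0) (-commutatorMap (L 1 * L 1))
    (fun i k => Y k * L (2 * i)) (fun i k => Y k * L (2 * i + 1))
    (fun i k => h.shift_Y_mul (shift_L hC _) _) (fun i k => h.shift_Y_mul (shift_L hC _) _)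
    (fun m => L (2 * m) * Y 1 - Y 1 * L (2 * m)) (by simp [h.L_zero, h.L'_zero]) ?_ n
  · simpa [sub_eq_add_neg, add_assoc] using key
  intro m
  have e1 := h.L_even_comm_Y_one hC m
  have e2 := h.L_odd_comm_Y_two hC m
  simp only [map_sub, map_add, map_smul, h.shift_mul_Y (shift_L hC _),
    h.shift_Y_mul (shift_L hC _), h.shift_mul_Y (h.shift_L' hC _), h.shift_Y_mul (h.shift_L' hC _),
    zero_add, Nat.reduceAdd, pow_succ, pow_mul, one_pow, neg_one_sq] at e1 e2 ⊢
  linear_combination (norm := skip) e1 + q • e2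
  simp only [theta, mul_add, mul_one, zero_add, Nat.reduceAdd, add_assoc]
  match_scalars <;> field_simp <;> ring

theorem L'_even_comm_Y_two_eq (h : RootVectors q X Y L L')
    (hC : ∀ n, L 1 * L 1 * L n = L n * (L 1 * L 1)) (n : ℕ) :
    L' (2 * n) * Y 2 - Y 2 * L' (2 * n) =
      (∑ i ∈ Finset.range n,
        (q ^ (2 * n - 1 - 2 * i) * theta q) • (Y (2 * n + 2 - 2 * i) * L' (2 * i))) -
      ∑ i ∈ Finset.range n,
        (q ^ (2 * n - 2 - 2 * i) * theta q) • (Y (2 * n + 1 - 2 * i) * L' (2 * i + 1)) := by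
  have hq := h.q_ne_zero
  have key := closed_form_pow (q := q) (θ := theta q) (s := -1) (c := 1)
    (-commutatorMap (L 1 * L 1))
    (fun i k => Y k * L' (2 * i)) (fun i k => Y k * L' (2 * i + 1))
    (fun i k => h.shift_Y_mul (h.shift_L' hC _) _) (fun i k => h.shift_Y_mul (h.shift_L' hC _) _)
    (fun m => L' (2 * m) * Y 2 - Y 2 * L' (2 * m)) (by simp [h.L_zero, h.L'_zero]) ?_ n
  · simpa [sub_eq_add_neg, add_assoc] using key
  intro m
  have e1 := h.L'_even_comm_Y_two hC m
  have e2 := congrArg (-commutatorMap (L 1 * L 1)) (h.L'_odd_comm_Y_one hC m)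
  simp only [map_sub, map_add, map_smul, h.shift_mul_Y (shift_L hC _),
    h.shift_Y_mul (shift_L hC _), h.shift_mul_Y (h.shift_L' hC _), h.shift_Y_mul (h.shift_L' hC _),
    zero_add, Nat.reduceAdd, pow_succ, pow_mul, one_pow, neg_one_sq] at e1 e2 ⊢
  linear_combination (norm := skip) e1 + q • e2
  simp only [theta, mul_add, mul_one, zero_add, Nat.reduceAdd, add_assoc]
  match_scalars <;> field_simp <;> ring

theorem X_one_comm_L_even (h : RootVectors q X Y L L')
    (hC : ∀ n, L 1 * L 1 * L n = L n * (L 1 * L 1)) (n : ℕ) :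
    X 1 * L (2 * n) - L (2 * n) * X 1 =
      (∑ i ∈ Finset.range n,
        (polyP q (2 * n - 1 - 2 * i) * theta q) • (L (2 * i) * X (2 * n + 1 - 2 * i))) -
      ∑ i ∈ Finset.range n,
        (polyP q (2 * n - 2 - 2 * i) * theta q) • (L' (2 * i + 1) * X (2 * n - 2 * i)) := by
  have hq := h.q_ne_zero
  have hθ : theta q ≠ 0 := h.theta_ne_zero
  have key := (closed_form_polyP (q := q) (θ := theta q) (c := 0) (commutatorMap (L 1 * L 1))
    (fun i k => L (2 * i) * X k) (fun i k => L' (2 * i + 1) * X k)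
    (fun i k => h.shift_mul_X (shift_L hC _) _) (fun i k => h.shift_mul_X (h.shift_L' hC _) _)
    (fun m => X 1 * L (2 * m) - L (2 * m) * X 1)
    (fun m => X 2 * L' (2 * m + 1) + L' (2 * m + 1) * X 2) (by simp [h.L_zero, h.L'_zero])
    ?_ ?_ ?_ n).1
  · simpa [add_assoc] using key
  · simp only [mul_zero, zero_add, h.L_zero, h.L'_one, smul_mul_assoc, mul_smul_comm, one_mul,
      mul_one, smul_smul, Nat.reduceAdd]
    rw [h.X_three, mul_one_div_cancel hθ]
    module
  · intro m
    have e2 := h.X_two_comm_L' hC (2 * m + 1)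
    simp only [map_sub, map_add, map_neg, map_smul, h.shift_mul_X (shift_L hC _),
      h.shift_X_mul (shift_L hC _), h.shift_mul_X (h.shift_L' hC _),
      h.shift_X_mul (h.shift_L' hC _), zero_add, Nat.reduceAdd, Nat.reduceMul, mul_add, mul_one,
      add_assoc, pow_add, pow_mul, one_pow, neg_one_sq, pow_one, one_mul, mul_zero] at e2 ⊢
    linear_combination (norm := skip) e2
    simp only [theta]
    match_scalars <;> field_simp <;> ring
  · intro m
    have e1 := h.X_one_comm_L hC (2 * m)
    simp only [map_sub, map_add, map_neg, map_smul, h.shift_mul_X (shift_L hC _),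
      h.shift_X_mul (shift_L hC _), h.shift_mul_X (h.shift_L' hC _),
      h.shift_X_mul (h.shift_L' hC _), zero_add, Nat.reduceAdd, Nat.reduceMul, mul_add, mul_one,
      add_assoc, pow_add, pow_mul, one_pow, neg_one_sq, pow_one, one_mul, mul_zero] at e1 ⊢
    linear_combination (norm := skip) e1
    simp only [theta]
    match_scalars <;> field_simp <;> ring

theorem L_even_comm_Y_two_eq (h : RootVectors q X Y L L')
    (hC : ∀ n, L 1 * L 1 * L n = L n * (L 1 * L 1)) (n : ℕ) :
    L (2 * n) * Y 2 - Y 2 * L (2 * n) =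
      (∑ i ∈ Finset.range n,
        (polyP q (2 * n - 1 - 2 * i) * theta q) • (Y (2 * n + 2 - 2 * i) * L (2 * i))) -
      ∑ i ∈ Finset.range n,
        (polyP q (2 * n - 2 - 2 * i) * theta q) • (Y (2 * n + 1 - 2 * i) * L (2 * i + 1)) := by
  have hq := h.q_ne_zero
  have hθ : theta q ≠ 0 := h.theta_ne_zero
  have key := (closed_form_polyP (q := q) (θ := theta q) (c := 1) (-commutatorMap (L 1 * L 1))
    (fun i k => Y k * L (2 * i)) (fun i k => Y k * L (2 * i + 1))
    (fun i k => h.shift_Y_mul (shift_L hC _) _) (fun i k => h.shift_Y_mul (shift_L hC _) _)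
    (fun m => L (2 * m) * Y 2 - Y 2 * L (2 * m))
    (fun m => L (2 * m + 1) * Y 3 + Y 3 * L (2 * m + 1)) (by simp [h.L_zero, h.L'_zero])
    ?_ ?_ ?_ n).1
  · simpa [add_assoc] using key
  · simp only [mul_zero, zero_add, h.L_zero, h.L'_one, smul_mul_assoc, mul_smul_comm, one_mul,
      mul_one, smul_smul, Nat.reduceAdd]
    rw [h.Y_four, mul_one_div_cancel hθ]
    module
  · intro m
    have e2 := congrArg (-commutatorMap (L 1 * L 1)) (h.L_odd_comm_Y_one hC m)
    simp only [map_sub, map_add, map_neg, map_smul, h.shift_mul_Y (shift_L hC _),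
      h.shift_Y_mul (shift_L hC _), h.shift_mul_Y (h.shift_L' hC _),
      h.shift_Y_mul (h.shift_L' hC _), zero_add, Nat.reduceAdd, Nat.reduceMul, mul_add, mul_one,
      add_assoc, pow_add, pow_mul, one_pow, neg_one_sq, pow_one, one_mul, mul_zero] at e2 ⊢
    linear_combination (norm := skip) e2
    simp only [theta]
    match_scalars <;> field_simp <;> ring
  · intro m
    have e1 := h.L_even_comm_Y_two hC m
    simp only [map_sub, map_add, map_neg, map_smul, h.shift_mul_Y (shift_L hC _),
      h.shift_Y_mul (shift_L hC _), h.shift_mul_Y (h.shift_L' hC _),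
      h.shift_Y_mul (h.shift_L' hC _), zero_add, Nat.reduceAdd, Nat.reduceMul, mul_add, mul_one,
      add_assoc, pow_add, pow_mul, one_pow, neg_one_sq, pow_one, one_mul, mul_zero] at e1 ⊢
    linear_combination (norm := skip) e1
    simp only [theta]
    match_scalars <;> field_simp <;> ring

/-- The quadratic relations for X₁, X₃ and X₂, X₄ trade roles under q ↦ -q, so the P-solution
applies with -q and -θ; the sign in front of the auxiliary sequence makes its recursion match. -/
theorem X_two_comm_L'_even (h : RootVectors q X Y L L')
    (hC : ∀ n, L 1 * L 1 * L n = L n * (L 1 * L 1)) (n : ℕ) :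
    X 2 * L' (2 * n) - L' (2 * n) * X 2 =
      (∑ i ∈ Finset.range n,
        (polyQ q (2 * n - 1 - 2 * i) * theta q) • (L' (2 * i) * X (2 * n + 2 - 2 * i))) +
      ∑ i ∈ Finset.range n,
        (polyQ q (2 * n - 2 - 2 * i) * theta q) • (L (2 * i + 1) * X (2 * n + 1 - 2 * i)) := by
  have hq := h.q_ne_zero
  have hθ : theta q ≠ 0 := h.theta_ne_zero
  have key := (closed_form_polyP (q := -q) (θ := -theta q) (c := 1) (commutatorMap (L 1 * L 1))
    (fun i k => L' (2 * i) * X k) (fun i k => L (2 * i + 1) * X k)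
    (fun i k => h.shift_mul_X (h.shift_L' hC _) _) (fun i k => h.shift_mul_X (shift_L hC _) _)
    (fun m => X 2 * L' (2 * m) - L' (2 * m) * X 2)
    (fun m => -(X 3 * L (2 * m + 1) - L (2 * m + 1) * X 3)) (by simp [h.L_zero, h.L'_zero])
    ?_ ?_ ?_ n).1
  · rw [sum_polyP_neg q 1 (fun i k => L' (2 * i) * X k) (fun i k => L (2 * i + 1) * X k)] at key
    simpa [add_assoc] using key
  · simp only [mul_zero, zero_add, h.L'_zero, h.L'_one, smul_mul_assoc, mul_smul_comm, one_mul,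
      mul_one, smul_smul, Nat.reduceAdd]
    rw [h.X_four, neg_mul, mul_one_div_cancel hθ]
    module
  · intro m
    have e2 := congrArg (commutatorMap (L 1 * L 1)) (h.X_one_comm_L hC (2 * m + 1))
    simp only [map_sub, map_add, map_neg, map_smul, h.shift_mul_X (shift_L hC _),
      h.shift_X_mul (shift_L hC _), h.shift_mul_X (h.shift_L' hC _),
      h.shift_X_mul (h.shift_L' hC _), zero_add, Nat.reduceAdd, Nat.reduceMul, mul_add, mul_one,
      add_assoc, pow_add, pow_mul, one_pow, neg_one_sq, pow_one, one_mul, mul_zero] at e2 ⊢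
    linear_combination (norm := skip) -e2
    simp only [theta]
    match_scalars <;> field_simp <;> ring
  · intro m
    have e1 := h.X_two_comm_L' hC (2 * m)
    simp only [map_sub, map_add, map_neg, map_smul, h.shift_mul_X (shift_L hC _),
      h.shift_X_mul (shift_L hC _), h.shift_mul_X (h.shift_L' hC _),
      h.shift_X_mul (h.shift_L' hC _), zero_add, Nat.reduceAdd, Nat.reduceMul, mul_add, mul_one,
      add_assoc, pow_add, pow_mul, one_pow, neg_one_sq, pow_one, one_mul, mul_zero] at e1 ⊢
    linear_combination (norm := skip) e1
    simp only [theta]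
    match_scalars <;> field_simp <;> ring

theorem L'_even_comm_Y_one_eq (h : RootVectors q X Y L L')
    (hC : ∀ n, L 1 * L 1 * L n = L n * (L 1 * L 1)) (n : ℕ) :
    L' (2 * n) * Y 1 - Y 1 * L' (2 * n) =
      (∑ i ∈ Finset.range n,
        (polyQ q (2 * n - 1 - 2 * i) * theta q) • (Y (2 * n + 1 - 2 * i) * L' (2 * i))) +
      ∑ i ∈ Finset.range n,
        (polyQ q (2 * n - 2 - 2 * i) * theta q) • (Y (2 * n - 2 * i) * L' (2 * i + 1)) := by
  have hq := h.q_ne_zero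
  have hθ : theta q ≠ 0 := h.theta_ne_zero
  have key := (closed_form_polyP (q := -q) (θ := -theta q) (c := 0) (-commutatorMap (L 1 * L 1))
    (fun i k => Y k * L' (2 * i)) (fun i k => Y k * L' (2 * i + 1))
    (fun i k => h.shift_Y_mul (h.shift_L' hC _) _) (fun i k => h.shift_Y_mul (h.shift_L' hC _) _)
    (fun m => L' (2 * m) * Y 1 - Y 1 * L' (2 * m))
    (fun m => -(L' (2 * m + 1) * Y 2 - Y 2 * L' (2 * m + 1))) (by simp [h.L_zero, h.L'_zero])
    ?_ ?_ ?_ n).1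
  · rw [sum_polyP_neg q 0 (fun i k => Y k * L' (2 * i)) (fun i k => Y k * L' (2 * i + 1))] at key
    simpa [add_assoc] using key
  · simp only [mul_zero, zero_add, h.L'_zero, h.L'_one, smul_mul_assoc, mul_smul_comm, one_mul,
      mul_one, smul_smul, Nat.reduceAdd]
    rw [h.Y_three, neg_mul, mul_one_div_cancel hθ]
    module
  · intro m
    have e2 := h.L'_odd_comm_Y_two hC m
    simp only [map_sub, map_add, map_neg, map_smul, h.shift_mul_Y (shift_L hC _),
      h.shift_Y_mul (shift_L hC _), h.shift_mul_Y (h.shift_L' hC _),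
      h.shift_Y_mul (h.shift_L' hC _), zero_add, Nat.reduceAdd, Nat.reduceMul, mul_add, mul_one,
      add_assoc, pow_add, pow_mul, one_pow, neg_one_sq, pow_one, one_mul, mul_zero] at e2 ⊢
    linear_combination (norm := skip) -e2
    simp only [theta]
    match_scalars <;> field_simp <;> ring
  · intro m
    have e1 := h.L'_even_comm_Y_one hC m
    simp only [map_sub, map_add, map_neg, map_smul, h.shift_mul_Y (shift_L hC _),
      h.shift_Y_mul (shift_L hC _), h.shift_mul_Y (h.shift_L' hC _),
      h.shift_Y_mul (h.shift_L' hC _), zero_add, Nat.reduceAdd, Nat.reduceMul, mul_add, mul_one,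
      add_assoc, pow_add, pow_mul, one_pow, neg_one_sq, pow_one, one_mul, mul_zero] at e1 ⊢
    linear_combination (norm := skip) e1
    simp only [theta]
    match_scalars <;> field_simp <;> ring

end RootVectors

end EvenRelations

end DiagonalNichols

namespace DiagonalNichols

noncomputable section

/-! ### Quantum Serre relations -/

section Serre

set_option linter.unusedSimpArgs false

variable {A : Type*} [Ring A] [Algebra ℂ A] {q : ℂ} {x y : A} {d₁ d₂ t₁ t₂ : A →ₗ[ℂ] A}

/-- Direct expansion in words in x and y; together with the vanishing constant term this yields the
Serre relation. -/
theorem SkewDerivations.serre_X (D : SkewDerivations q x y d₁ d₂ t₁ t₂) (hq : q ≠ 0) {l z : A}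
    (hl : l = x * y - q⁻¹ • (y * x)) (hz : z = x * l - l * x) :
    d₁ (x * z - q • (z * x)) = 0 ∧ d₂ (x * z - q • (z * x)) = 0 := by
  subst hz hl
  simp only [map_sub, map_smul, D.d₁_mul, D.d₂_mul, D.t₁_mul, D.t₂_mul, D.t₁_x, D.t₁_y, D.t₂_x,
    D.t₂_y, D.d₁_x, D.d₁_y, D.d₂_x, D.d₂_y, mul_add, add_mul, mul_sub, sub_mul, smul_mul_assoc,
    mul_smul_comm, mul_assoc, mul_one, one_mul, mul_zero, zero_mul, zero_add, add_zero, smul_zero,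
    sub_zero]
  constructor <;> match_scalars <;> field_simp <;> ring

theorem SkewDerivations.serre_Y (D : SkewDerivations q x y d₁ d₂ t₁ t₂) (hq : q ≠ 0) {l z : A}
    (hl : l = x * y - q⁻¹ • (y * x)) (hz : z = l * y + y * l) :
    d₁ (z * y - q • (y * z)) = 0 ∧ d₂ (z * y - q • (y * z)) = 0 := by
  subst hz hl
  simp only [map_sub, map_add, map_smul, D.d₁_mul, D.d₂_mul, D.t₁_mul, D.t₂_mul, D.t₁_x, D.t₁_y,
    D.t₂_x, D.t₂_y, D.d₁_x, D.d₁_y, D.d₂_x, D.d₂_y, mul_add, add_mul, mul_sub, sub_mul,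
    smul_mul_assoc, mul_smul_comm, mul_assoc, mul_one, one_mul, mul_zero, zero_mul, zero_add,
    add_zero, smul_zero, sub_zero]
  constructor <;> match_scalars <;> field_simp <;> ring

end Serre

/-! ### The root vectors of 𝕍 in the derivation quotient -/

section RankTwo

variable (q : ℂ)

theorem bichar_braidingMatrix (a b c d : ℕ) : bichar (braidingMatrix q) ![a, b] ![c, d] =
    q ^ (a * c) * q⁻¹ ^ (a * d) * (q⁻¹ ^ (b * c) * (-q) ^ (b * d)) := by
  simp [bichar, braidingMatrix, Fin.prod_univ_two]

theorem rootX_one : rootX q 1 = FreeAlgebra.ι ℂ 0 := by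
  simp [rootX, deltaWord_zero, superLetter_singleton]

theorem rootY_one : rootY q 1 = FreeAlgebra.ι ℂ 1 := by
  simp [rootY, deltaWord_zero, superLetter_singleton]

theorem rootL_one : rootL q 1 = superLetter (braidingMatrix q) [0, 1] := by
  rw [rootL, rootX_one, rootY_one, superLetter_delta]

theorem rootX_add_two (n : ℕ) :
    rootX q (n + 2) = bracket (braidingMatrix q) (rootX q (n + 1)) (rootL q 1) := by
  rw [rootL_one]
  cases n with
  | zero => rw [rootX_one, ← superLetter_zero_delta]; rfl
  | succ n => exact superLetter_zero_deltaWord _ n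

theorem rootY_add_two (n : ℕ) :
    rootY q (n + 2) = bracket (braidingMatrix q) (rootL q 1) (rootY q (n + 1)) := by
  rw [rootL_one]
  exact superLetter_deltaWord_append _ n

theorem ι_zero_mem_homogeneous :
    FreeAlgebra.ι ℂ (0 : Fin 2) ∈ homogeneous (![1, 0] : Fin 2 → ℕ) := by
  have h := word_mem_homogeneous [(0 : Fin 2)]
  have e : wordDegree [(0 : Fin 2)] = ![1, 0] := by decide
  rw [e] at h
  simpa [word] using h

theorem ι_one_mem_homogeneous :
    FreeAlgebra.ι ℂ (1 : Fin 2) ∈ homogeneous (![0, 1] : Fin 2 → ℕ) := by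
  have h := word_mem_homogeneous [(1 : Fin 2)]
  have e : wordDegree [(1 : Fin 2)] = ![0, 1] := by decide
  rw [e] at h
  simpa [word] using h

theorem bracket_mem {a b c d e f : ℕ} {u v : FreeAlgebra ℂ (Fin 2)} (hu : u ∈ homogeneous ![a, b])
    (hv : v ∈ homogeneous ![c, d]) (he : a + c = e) (hf : b + d = f) :
    bracket (braidingMatrix q) u v ∈ homogeneous ![e, f] := by
  subst he hf
  simpa using bracket_mem_homogeneous (braidingMatrix q) hu hv

theorem rootL_one_mem : rootL q 1 ∈ homogeneous ![1, 1] := by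
  rw [rootL_one, superLetter_delta]
  exact bracket_mem q ι_zero_mem_homogeneous ι_one_mem_homogeneous rfl rfl

theorem rootX_mem (n : ℕ) : rootX q (n + 1) ∈ homogeneous ![n + 1, n] := by
  induction n with
  | zero => rw [rootX_one]; exact ι_zero_mem_homogeneous
  | succ n ih => rw [rootX_add_two]; exact bracket_mem q ih (rootL_one_mem q) rfl rfl

theorem rootY_mem (n : ℕ) : rootY q (n + 1) ∈ homogeneous ![n, n + 1] := by
  induction n with
  | zero => rw [rootY_one]; exact ι_one_mem_homogeneous
  | succ n ih =>
    rw [rootY_add_two]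
    exact bracket_mem q (rootL_one_mem q) ih (by omega) (by omega)

theorem algebraMap_mem_homogeneous (c : ℂ) :
    algebraMap ℂ (FreeAlgebra ℂ (Fin 2)) c ∈ homogeneous ![0, 0] := by
  have h := word_mem_homogeneous ([] : List (Fin 2))
  have e : wordDegree ([] : List (Fin 2)) = ![0, 0] := by decide
  rw [e] at h
  rw [Algebra.algebraMap_eq_smul_one]
  exact Submodule.smul_mem _ _ (by simpa [word] using h)

theorem rootL_mem : ∀ n : ℕ, rootL q n ∈ homogeneous ![n, n]
  | 0 => algebraMap_mem_homogeneous _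
  | n + 1 => bracket_mem q (rootX_mem q 0) (rootY_mem q n) (by omega) (by omega)

theorem rootL'_mem : ∀ n : ℕ, rootL' q n ∈ homogeneous ![n, n]
  | 0 => algebraMap_mem_homogeneous _
  | 1 => rootL_one_mem q
  | n + 2 => bracket_mem q (rootX_mem q 1) (rootY_mem q n) (by omega) (by omega)

variable {q}

theorem bracket_eq {a b c d : ℕ} {s : ℂ} {u v : FreeAlgebra ℂ (Fin 2)}
    (hu : u ∈ homogeneous ![a, b]) (hv : v ∈ homogeneous ![c, d])
    (hs : q ^ (a * c) * q⁻¹ ^ (a * d) * (q⁻¹ ^ (b * c) * (-q) ^ (b * d)) = s) :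
    bracket (braidingMatrix q) u v = u * v - s • (v * u) := by
  rw [bracket_of_homogeneous _ hu hv, bichar_braidingMatrix, hs]

/-- Against degree (m, m), α₁ pairs to q^m q^{-m} = 1 but α₂ to (-1)^m, so the three companions
below require even degree. -/
theorem br_X_one (hq : q ≠ 0) {m : ℕ} {v : FreeAlgebra ℂ (Fin 2)} (hv : v ∈ homogeneous ![m, m]) :
    br q (rootX q 1) v = rootX q 1 * v - v * rootX q 1 := by
  rw [br, bracket_eq (s := 1) (rootX_mem q 0) hv, one_smul]
  simp [hq]

theorem br_X_two (hq : q ≠ 0) {n : ℕ} {v : FreeAlgebra ℂ (Fin 2)}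
    (hv : v ∈ homogeneous ![2 * n, 2 * n]) :
    br q (rootX q 2) v = rootX q 2 * v - v * rootX q 2 := by
  rw [br, bracket_eq (s := 1) (rootX_mem q 1) hv, one_smul]
  simp [hq]

theorem br_Y_one (hq : q ≠ 0) {n : ℕ} {v : FreeAlgebra ℂ (Fin 2)}
    (hv : v ∈ homogeneous ![2 * n, 2 * n]) :
    br q v (rootY q 1) = v * rootY q 1 - rootY q 1 * v := by
  rw [br, bracket_eq (s := 1) hv (rootY_mem q 0), one_smul]
  simp [hq]

theorem br_Y_two (hq : q ≠ 0) {n : ℕ} {v : FreeAlgebra ℂ (Fin 2)}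
    (hv : v ∈ homogeneous ![2 * n, 2 * n]) :
    br q v (rootY q 2) = v * rootY q 2 - rootY q 2 * v := by
  rw [br, bracket_eq (s := 1) hv (rootY_mem q 1), one_smul]
  rw [Even.neg_pow ⟨2 * n, by ring⟩]
  simp only [inv_pow]
  field_simp

theorem skewDerivations (q : ℂ) :
    SkewDerivations q (toDer (braidingMatrix q) (rootX q 1)) (toDer (braidingMatrix q) (rootY q 1))
      (skewDerQ (braidingMatrix q) 0) (skewDerQ (braidingMatrix q) 1)
      (twistQ (braidingMatrix q) 0) (twistQ (braidingMatrix q) 1) where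
  t₁_mul := twistQ_mul _ _
  t₂_mul := twistQ_mul _ _
  d₁_mul := skewDerQ_mul _ _
  d₂_mul := skewDerQ_mul _ _
  t₁_x := by rw [rootX_one, twistQ_toDer, twist_ι, map_smul]; simp [braidingMatrix]
  t₁_y := by rw [rootY_one, twistQ_toDer, twist_ι, map_smul]; simp [braidingMatrix]
  t₂_x := by rw [rootX_one, twistQ_toDer, twist_ι, map_smul]; simp [braidingMatrix]
  t₂_y := by rw [rootY_one, twistQ_toDer, twist_ι, map_smul]; simp [braidingMatrix]
  d₁_x := by rw [rootX_one, skewDerQ_toDer, skewDer_ι]; simp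
  d₁_y := by rw [rootY_one, skewDerQ_toDer, skewDer_ι]; simp
  d₂_x := by rw [rootX_one, skewDerQ_toDer, skewDer_ι]; simp
  d₂_y := by rw [rootY_one, skewDerQ_toDer, skewDer_ι]; simp
  commute_of a b h₁ h₂ := by
    obtain ⟨u, rfl⟩ := toDer_surjective _ a
    obtain ⟨v, rfl⟩ := toDer_surjective _ b
    rw [← map_mul, ← map_mul, ← map_sub] at h₁ h₂
    rw [← sub_eq_zero, ← map_mul, ← map_mul, ← map_sub]
    -- A commutator has no constant term, since the augmentation takes values in a commutative ring.
    refine toDer_eq_zero _ _ (by simp [mul_comm]) fun i => ?_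
    fin_cases i
    · exact h₁
    · exact h₂

theorem rootVectors (hq0 : q ≠ 0) (hq : ∀ k : ℕ, 0 < k → q ^ k ≠ 1) :
    RootVectors q (fun n => toDer (braidingMatrix q) (rootX q n))
      (fun n => toDer (braidingMatrix q) (rootY q n))
      (fun n => toDer (braidingMatrix q) (rootL q n))
      (fun n => toDer (braidingMatrix q) (rootL' q n)) := by
  have hXs (n : ℕ) : rootX q (n + 2) =
      rootX q (n + 1) * rootL q 1 - (-1 : ℂ) ^ n • (rootL q 1 * rootX q (n + 1)) := by
    rw [rootX_add_two]
    refine bracket_eq (rootX_mem q n) (rootL_one_mem q) ?_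
    rw [neg_pow]
    simp only [inv_pow, mul_one]
    field_simp
  have hYs (n : ℕ) : rootY q (n + 2) =
      rootL q 1 * rootY q (n + 1) + (-1 : ℂ) ^ n • (rootY q (n + 1) * rootL q 1) := by
    rw [rootY_add_two, bracket_eq (s := -(-1) ^ n) (rootL_one_mem q) (rootY_mem q n), neg_smul,
      sub_neg_eq_add]
    rw [neg_pow]
    simp only [inv_pow, one_mul]
    field_simp
    ring
  have hLs (n : ℕ) : rootL q (n + 1) =
      rootX q 1 * rootY q (n + 1) - q⁻¹ • (rootY q (n + 1) * rootX q 1) := by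
    refine bracket_eq (rootX_mem q 0) (rootY_mem q n) ?_
    simp only [inv_pow, zero_add, one_mul, zero_mul, pow_zero, mul_one]
    field_simp
    ring
  have hL's (n : ℕ) : rootL' q (n + 2) =
      rootX q 2 * rootY q (n + 1) + ((-1) ^ n * q⁻¹) • (rootY q (n + 1) * rootX q 2) := by
    rw [rootL', bracket_eq (s := -((-1) ^ n * q⁻¹)) (rootX_mem q 1) (rootY_mem q n), neg_smul,
      sub_neg_eq_add]
    rw [neg_pow]
    simp only [inv_pow, one_mul]
    field_simp
    ring
  have hl := congrArg (toDer (braidingMatrix q)) (hLs 0)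
  have hx := congrArg (toDer (braidingMatrix q)) (hXs 0)
  have hy := congrArg (toDer (braidingMatrix q)) (hYs 0)
  simp only [pow_zero, one_smul, zero_add, map_sub, map_add, map_mul, map_smul] at hl hx hy
  have sX := (skewDerivations q).serre_X hq0 hl hx
  have sY := (skewDerivations q).serre_Y hq0 hl hy
  have cx : counit (rootX q 1) = 0 := by rw [rootX_one, counit_ι]
  have cy : counit (rootY q 1) = 0 := by rw [rootY_one, counit_ι]
  simp only [← map_mul, ← map_smul, ← map_sub] at sX sY
  refine ⟨hq0, hq, fun n => ?_, fun n => ?_, ?_, ?_, rfl, fun n => ?_, fun n => ?_, ?_, ?_⟩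
  · simp only [hXs n, map_sub, map_mul, map_smul]
  · simp only [hYs n, map_add, map_mul, map_smul]
  · simp [rootL, Algebra.algebraMap_eq_smul_one]
  · simp [rootL', Algebra.algebraMap_eq_smul_one]
  · simp only [hLs n, map_sub, map_mul, map_smul]
  · simp only [hL's n, map_add, map_mul, map_smul]
  · simp only [← map_mul, ← map_smul]
    rw [← sub_eq_zero, ← map_sub]
    refine toDer_eq_zero _ _ (by simp [cx]) fun i => ?_
    fin_cases i
    exacts [sX.1, sX.2]
  · simp only [← map_mul, ← map_smul]
    rw [← sub_eq_zero, ← map_sub]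
    refine toDer_eq_zero _ _ (by simp [cy]) fun i => ?_
    fin_cases i
    exacts [sY.1, sY.2]

end RankTwo

end

end DiagonalNichols

open DiagonalNichols in
theorem mainTheorem9 (q : ℂ) (hq0 : q ≠ 0) (hq : ∀ k : ℕ, 0 < k → q ^ k ≠ 1) (n : ℕ) :
    (toB q (br q (rootX q 1) (rootL q (2 * n))) =
        (∑ i ∈ Finset.range n,
            (polyP q (2 * n - 1 - 2 * i) * theta q) • (toB q (rootL q (2 * i)) * toB q (rootX q (2 * n + 1 - 2 * i))))
          - (∑ i ∈ Finset.range n,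
            (polyP q (2 * n - 2 - 2 * i) * theta q) • (toB q (rootL' q (2 * i + 1)) * toB q (rootX q (2 * n - 2 * i))))) ∧
    (toB q (br q (rootX q 1) (rootL' q (2 * n))) =
        (∑ i ∈ Finset.range n,
            (q ^ (2 * n - 1 - 2 * i) * theta q) • (toB q (rootL' q (2 * i)) * toB q (rootX q (2 * n + 1 - 2 * i))))
          - (∑ i ∈ Finset.range n,
            (q ^ (2 * n - 2 - 2 * i) * theta q) • (toB q (rootL q (2 * i + 1)) * toB q (rootX q (2 * n - 2 * i))))) ∧
    (toB q (br q (rootX q 2) (rootL q (2 * n))) =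
        (∑ i ∈ Finset.range n,
            (q ^ (2 * n - 1 - 2 * i) * theta q) • (toB q (rootL q (2 * i)) * toB q (rootX q (2 * n + 2 - 2 * i))))
          + (∑ i ∈ Finset.range n,
            (q ^ (2 * n - 2 - 2 * i) * theta q) • (toB q (rootL' q (2 * i + 1)) * toB q (rootX q (2 * n + 1 - 2 * i))))) ∧
    (toB q (br q (rootX q 2) (rootL' q (2 * n))) =
        (∑ i ∈ Finset.range n,
            (polyQ q (2 * n - 1 - 2 * i) * theta q) • (toB q (rootL' q (2 * i)) * toB q (rootX q (2 * n + 2 - 2 * i))))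
          + (∑ i ∈ Finset.range n,
            (polyQ q (2 * n - 2 - 2 * i) * theta q) • (toB q (rootL q (2 * i + 1)) * toB q (rootX q (2 * n + 1 - 2 * i))))) ∧
    (toB q (br q (rootL q (2 * n)) (rootY q 1)) =
        (∑ i ∈ Finset.range n,
            (q ^ (2 * n - 1 - 2 * i) * theta q) • (toB q (rootY q (2 * n + 1 - 2 * i)) * toB q (rootL q (2 * i))))
          + (∑ i ∈ Finset.range n,
            (q ^ (2 * n - 2 - 2 * i) * theta q) • (toB q (rootY q (2 * n - 2 * i)) * toB q (rootL q (2 * i + 1))))) ∧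
    (toB q (br q (rootL' q (2 * n)) (rootY q 1)) =
        (∑ i ∈ Finset.range n,
            (polyQ q (2 * n - 1 - 2 * i) * theta q) • (toB q (rootY q (2 * n + 1 - 2 * i)) * toB q (rootL' q (2 * i))))
          + (∑ i ∈ Finset.range n,
            (polyQ q (2 * n - 2 - 2 * i) * theta q) • (toB q (rootY q (2 * n - 2 * i)) * toB q (rootL' q (2 * i + 1))))) ∧
    (toB q (br q (rootL q (2 * n)) (rootY q 2)) =
        (∑ i ∈ Finset.range n,
            (polyP q (2 * n - 1 - 2 * i) * theta q) • (toB q (rootY q (2 * n + 2 - 2 * i)) * toB q (rootL q (2 * i))))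
          - (∑ i ∈ Finset.range n,
            (polyP q (2 * n - 2 - 2 * i) * theta q) • (toB q (rootY q (2 * n + 1 - 2 * i)) * toB q (rootL q (2 * i + 1))))) ∧
    (toB q (br q (rootL' q (2 * n)) (rootY q 2)) =
        (∑ i ∈ Finset.range n,
            (q ^ (2 * n - 1 - 2 * i) * theta q) • (toB q (rootY q (2 * n + 2 - 2 * i)) * toB q (rootL' q (2 * i))))
          - (∑ i ∈ Finset.range n,
            (q ^ (2 * n - 2 - 2 * i) * theta q) • (toB q (rootY q (2 * n + 1 - 2 * i)) * toB q (rootL' q (2 * i + 1))))) := by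
  have h := rootVectors hq0 hq
  have hC := fun k => h.commute_L (skewDerivations q) k
  -- In even degree all eight brackets are plain commutators; collecting each side under the
  -- projection lets the relations be checked in the derivation quotient.
  simp only [br_X_one hq0 (rootL_mem q _), br_X_one hq0 (rootL'_mem q _),
    br_X_two hq0 (rootL_mem q _), br_X_two hq0 (rootL'_mem q _),
    br_Y_one hq0 (rootL_mem q _), br_Y_one hq0 (rootL'_mem q _),
    br_Y_two hq0 (rootL_mem q _), br_Y_two hq0 (rootL'_mem q _), toB,
    ← map_mul, ← map_smul, ← map_sum, ← map_sub, ← map_add]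
  refine ⟨?_, ?_, ?_, ?_, ?_, ?_, ?_, ?_⟩ <;> apply toNichols_eq_of_toDer_eq <;>
    simp only [map_mul, map_smul, map_sum, map_sub, map_add]
  · exact h.X_one_comm_L_even hC n
  · exact h.X_one_comm_L'_even hC n
  · exact h.X_two_comm_L_even hC n
  · exact h.X_two_comm_L'_even hC n
  · exact h.L_even_comm_Y_one_eq hC n
  · exact h.L'_even_comm_Y_one_eq hC n
  · exact h.L_even_comm_Y_two_eq hC n
  · exact h.L'_even_comm_Y_two_eq hC n
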